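/- Let $M$ be a model of ZFC (in particular, any model of ZF + $V=L$), and let $\mathcal A$ be a coherent realizability algebra in $M$, with set of terms $\Lambda$, set of stacks $\Pi$, pole $\bot\!\!\!\bot$ and set of proof-like terms $\mathrm{QP}$ (all of these sets and the operations of $\mathcal A$ being elements of $M$). That is, $\mathcal A$ has operations $(\xi,\eta)\mapsto(\xi)\eta$ (application, $\Lambda^2\to\Lambda$), $(\xi,\pi)\mapsto\xi\cdot\pi$ (push, $\Lambda\times\Pi\to\Pi$), $(\xi,\pi)\mapsto\xi\star\pi$ (process, $\Lambda\times\Pi\to\Lambda\star\Pi$), $\pi\mapsto k_\pi$ (continuation, $\Pi\to\Lambda$) and elements $B,C,I,K,W,cc\in\Lambda$; $\succ$ is the least preorder on $\Lambda\star\Pi$ such that $(\xi)\eta\star\pi\succ\xi\star\eta\cdot\pi$, $I\star\xi\cdot\pi\succ\xi\star\pi$, $K\star\xi\cdot\eta\cdot\pi\succ\xi\star\pi$, $W\star\xi\cdot\eta\cdot\pi\succ\xi\star\eta\cdot\eta\cdot\pi$, $C\star\xi\cdot\eta\cdot\zeta\cdot\pi\succ\xi\star\zeta\cdot\eta\cdot\pi$,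 $B\star\xi\cdot\eta\cdot\zeta\cdot\pi\succ\xi\star(\eta)\zeta\cdot\pi$, $cc\star\xi\cdot\pi\succ\xi\star k_\pi\cdot\pi$, $k_\pi\star\xi\cdot\varpi\succ\xi\star\pi$; the set $\bot\!\!\!\bot\subseteq\Lambda\star\Pi$ is such that $p\succ q\in\bot\!\!\!\bot$ implies $p\in\bot\!\!\!\bot$; $\mathrm{QP}\subseteq\Lambda$ contains $B,C,I,K,W,cc$ and is closed under application; and coherent means that for every $\theta\in\mathrm{QP}$ there is $\pi\in\Pi$ with $\theta\star\pi\notin\bot\!\!\!\bot$. Let $\mathcal N$ be the realizability model of $\mathcal A$: its individuals are the elements of $M$, its language has the relation symbols $\mathrel{\not\varepsilon}$, $\notin$, $\subset$ and a function symbol for every functional definable in $M$ with parameters, each closed formula $F$ has a truth value $\|F\|\subseteq\Pi$ with, in particular, $\|\bot\|=\Pi$, $\|a\mathrel{\not\varepsilon}b\|=\{\pi\in\Pi : (a,\pi)\in b\}$, $\|F\to G\|=\{\xi\cdot\pi : \xi\Vdash F,\ \pi\in\|G\|\}$ and $\|\forall x\,F[x]\|=\bigcup_{a\in M}\|F[a]\|$,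 where $\xi\Vdash F$ means that $\xi\star\pi\in\bot\!\!\!\bot$ for all $\pi\in\|F\|$; and $\mathcal N$ realizes $F$ if $\theta\Vdash F$ for some $\theta\in\mathrm{QP}$. For $X\in M$ put $\gimel X=X\times\Pi$ and $\|\forall x^{\gimel X}F[x]\|=\bigcup_{a\in X}\|F[a]\|$; write $\exists x^{\gimel X}$ for $\neg\forall x^{\gimel X}\neg$. For terms $t,u$ let $\|t\neq u\|$ be $\Pi$ if $t=u$ in $M$ and $\emptyset$ otherwise. Let $2=\{0,1\}$, let $\kappa$ be the cardinal, in $M$, of $\Lambda\cup\Pi\cup\mathbb N$, and let $\kappa_+=\mathcal P(\kappa)$, the power set in $M$. "$E$ cannot be well ordered" is the formula saying that no individual $R$ is such that the relation $(x,y)\mathrel{\varepsilon}R$ is a strict well ordering of the $\varepsilon$-elements of $E$ (where $x\mathrel{\varepsilon}y$ is the negation of $x\mathrel{\not\varepsilon}y$; irreflexive, transitive, total with respect to Leibniz equality $\forall z(x\mathrel{\not\varepsilon}z\to y\mathrel{\not\varepsilon}z)$, and such that every individual having an $\varepsilon$-element in common with $E$ has a minimal such element). Then $\mathcal N$ realizes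 both formulas 1. $\forall i^{\gimel 2}\bigl(i\neq 0,\ i\neq 1\ \to\ (\gimel\kappa_+\text{ cannot be well ordered})\bigr)$; 2. $\exists i^{\gimel 2}(i\neq 0\wedge i\neq 1)\ \to\ \exists E\,(E\text{ cannot be well ordered})$, i.e. if the characteristic Boolean algebra $\gimel 2$ is not trivial, there is an individual which cannot be well ordered. -/

import Mathlib

/-! ## The ground model: first-order models of ZFC -/

namespace ClassicalRealizability

/-- The relation symbols of the language of set theory: one binary symbol. -/
inductive MemRel : ℕ → Type
  | mem : MemRel 2

/-- The first-order language of set theory, with a single binary relation symbol. -/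
def setLang : FirstOrder.Language.{0, 0} := ⟨fun _ => Empty, MemRel⟩

/-- Every type with a membership relation is a structure for the language of set theory. -/
instance setStructure (M : Type*) [Membership M M] : setLang.Structure M where
  funMap := fun f => nomatch f
  RelMap := fun r v =>
    match r, v with
    | MemRel.mem, v => v 0 ∈ v 1

/-- `C` is a class of `M`: it is defined by a formula of set theory with parameters in `M`. -/
def IsClass {M : Type*} [Membership M M] (C : Set M) : Prop :=
  (Set.univ : Set M).Definable₁ setLang C

/-- `G` is a binary class relation of `M`: it is defined by a formula with parameters in `M`. -/
def IsClassRel {M : Type*} [Membership M M] (G : Set (M × M)) : Prop :=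
  (Set.univ : Set M).Definable₂ setLang G

/-- `f` is an `n`-ary functional of `M`: its graph is defined by a formula of set theory with
parameters in `M`. -/
def IsFunctional {M : Type*} [Membership M M] {n : ℕ} (f : (Fin n → M) → M) : Prop :=
  (Set.univ : Set M).DefinableFun setLang f

/-- `(M, ∈)` is a model of first-order ZFC. It may be countable, ill-founded, etc.: `∈` is an
arbitrary binary relation on the type `M`. -/
class ZFCModel (M : Type*) [Membership M M] : Prop where
  extensionality : ∀ a b : M, (∀ x : M, x ∈ a ↔ x ∈ b) → a = b
  foundation : ∀ a : M, (∃ x : M, x ∈ a) → ∃ x : M, x ∈ a ∧ ∀ y : M, y ∈ x → ¬ y ∈ a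
  pairing : ∀ a b : M, ∃ c : M, ∀ x : M, x ∈ c ↔ x = a ∨ x = b
  union : ∀ a : M, ∃ b : M, ∀ x : M, x ∈ b ↔ ∃ y : M, y ∈ a ∧ x ∈ y
  powerset : ∀ a : M, ∃ b : M, ∀ x : M, x ∈ b ↔ ∀ y : M, y ∈ x → y ∈ a
  infinity : ∃ a : M, (∃ e : M, e ∈ a ∧ ∀ x : M, ¬ x ∈ e) ∧
    ∀ x : M, x ∈ a → ∃ y : M, y ∈ a ∧ ∀ z : M, z ∈ y ↔ z ∈ x ∨ z = x
  separation : ∀ C : Set M, IsClass C → ∀ a : M, ∃ b : M, ∀ x : M, x ∈ b ↔ x ∈ a ∧ x ∈ C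
  replacement : ∀ G : Set (M × M), IsClassRel G → ∀ a : M,
    (∀ x : M, x ∈ a → ∀ y z : M, (x, y) ∈ G → (x, z) ∈ G → y = z) →
      ∃ b : M, ∀ y : M, y ∈ b ↔ ∃ x : M, x ∈ a ∧ (x, y) ∈ G
  choice : ∀ a : M, (∀ x : M, x ∈ a → ∃ y : M, y ∈ x) →
    (∀ x y z : M, x ∈ a → y ∈ a → z ∈ x → z ∈ y → x = y) →
      ∃ c : M, ∀ x : M, x ∈ a → ∃! y : M, y ∈ x ∧ y ∈ c

section GroundModel

variable {M : Type*} [Membership M M]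

/-- The set `{x | P x}` of the model `M`, for a predicate `P` whose extension is a set of `M`. -/
noncomputable def collect [ZFCModel M] (P : M → Prop) : M :=
  Classical.epsilon (h := ⟨(ZFCModel.infinity (M := M)).choose⟩) fun b : M => ∀ x : M, x ∈ b ↔ P x

theorem mem_collect [ZFCModel M] {P : M → Prop} (h : ∃ b : M, ∀ x : M, x ∈ b ↔ P x) (x : M) :
    x ∈ collect P ↔ P x :=
  Classical.epsilon_spec h x

theorem isFunctional_const {n : ℕ} (a : M) : IsFunctional fun _ : Fin n → M => a :=
  setLang.definableFun_const _ (Set.mem_univ a)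

theorem definable_mem {α : Type*} {f g : (α → M) → M}
    (hf : (Set.univ : Set M).DefinableFun setLang f)
    (hg : (Set.univ : Set M).DefinableFun setLang g) :
    (Set.univ : Set M).Definable setLang {v | f v ∈ g v} := by
  have hm : (Set.univ : Set M).DefinableMap setLang fun v => ![f v, g v] := by
    intro i
    fin_cases i
    · exact hf
    · exact hg
  have h0 : (∅ : Set M).Definable setLang {v : Fin 2 → M | v 0 ∈ v 1} := by
    rw [Set.empty_definable_iff]
    let r : setLang.Relations 2 := MemRel.mem
    refine ⟨r.formula₂ (FirstOrder.Language.Term.var 0) (FirstOrder.Language.Term.var 1), ?_⟩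
    ext v
    change v 0 ∈ v 1 ↔ FirstOrder.Language.Formula.Realize _ v
    rw [FirstOrder.Language.Formula.realize_rel₂]
    rfl
  exact (h0.mono (Set.empty_subset _)).preimage_map hm

variable [ZFCModel M]

/-- The empty set of `M`. -/
noncomputable def emp : M := collect fun _ => False

/-- The unordered pair `{a, b}` of `M`. -/
noncomputable def upair (a b : M) : M := collect fun x => x = a ∨ x = b

/-- The ordered pair `(a, b) = {{a}, {a, b}}` of `M`. -/
noncomputable def opair (a b : M) : M := upair (upair a a) (upair a b)

/-- The union `a ∪ b` in `M`. -/
noncomputable def cup (a b : M) : M := collect fun x => x ∈ a ∨ x ∈ b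

/-- The power set of `a` in `M`. -/
noncomputable def power (a : M) : M := collect fun x => ∀ y : M, y ∈ x → y ∈ a

/-- The cartesian product `a × b` in `M`. -/
noncomputable def prod (a b : M) : M :=
  collect fun z => ∃ x y : M, x ∈ a ∧ y ∈ b ∧ z = opair x y

/-- `a` contains `∅` and is closed under `x ↦ x ∪ {x}`. -/
def IsInductive (a : M) : Prop :=
  (∀ e : M, (∀ x : M, ¬ x ∈ e) → e ∈ a) ∧
    ∀ x y : M, x ∈ a → (∀ z : M, z ∈ y ↔ z ∈ x ∨ z = x) → y ∈ a

/-- The set `ℕ` of `M`, the least inductive set. -/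
noncomputable def omega : M := collect fun n => ∀ a : M, IsInductive a → n ∈ a

/-- `0 = ∅`. -/
noncomputable def zero : M := emp

/-- `1 = {0}`. -/
noncomputable def one : M := upair zero zero

/-- `2 = {0, 1}`. -/
noncomputable def two : M := upair zero one

/-- `a` is transitive. -/
def IsTrans (a : M) : Prop := ∀ x y : M, x ∈ a → y ∈ x → y ∈ a

/-- `a` is an ordinal of `M`: a transitive set of transitive sets. -/
def IsOrd (a : M) : Prop := IsTrans a ∧ ∀ x : M, x ∈ a → IsTrans x

/-- There is in `M` a bijection from `a` onto `b`. -/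
def Equipotent (a b : M) : Prop :=
  ∃ f : M, (∀ z : M, z ∈ f → ∃ x y : M, x ∈ a ∧ y ∈ b ∧ z = opair x y) ∧
    (∀ x : M, x ∈ a → ∃! y : M, opair x y ∈ f) ∧
    (∀ y : M, y ∈ b → ∃! x : M, opair x y ∈ f)

/-- `k` is the cardinal of `a` in `M`: the least ordinal equipotent with `a`. -/
def IsCardinalOf (k a : M) : Prop :=
  IsOrd k ∧ Equipotent k a ∧ ∀ m : M, m ∈ k → ¬ Equipotent m a

/-- The type of elements of the set `a` of `M`. -/
abbrev Elts (a : M) : Type _ := {x : M // x ∈ a}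

/-! Each of the sets above exists in `M`. -/

theorem mem_emp (x : M) : ¬ x ∈ (emp : M) := by
  obtain ⟨a, ⟨e, -, he⟩, -⟩ := ZFCModel.infinity (M := M)
  exact (mem_collect ⟨e, fun x => iff_false_intro (he x)⟩ x).1

theorem mem_upair (a b x : M) : x ∈ upair a b ↔ x = a ∨ x = b :=
  mem_collect (ZFCModel.pairing a b) x

theorem mem_cup (a b x : M) : x ∈ cup a b ↔ x ∈ a ∨ x ∈ b := by
  refine mem_collect ?_ x
  obtain ⟨c, hc⟩ := ZFCModel.union (upair a b)
  refine ⟨c, fun x => (hc x).trans ?_⟩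
  simp [mem_upair]

theorem mem_power (a x : M) : x ∈ power a ↔ ∀ y : M, y ∈ x → y ∈ a :=
  mem_collect (ZFCModel.powerset a) x

theorem isFunctional_upair : IsFunctional fun v : Fin 2 → M => upair (v 0) (v 1) := by
  have key : (∅ : Set M).DefinableFun setLang fun v : Fin 2 → M => upair (v 0) (v 1) := by
    rw [Set.empty_definableFun_iff]
    let r : setLang.Relations 2 := MemRel.mem
    let φ : setLang.Formula (Option (Fin 2)) :=
      FirstOrder.Language.BoundedFormula.all
        ((r.boundedFormula₂ (FirstOrder.Language.Term.var (Sum.inr 0))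
            (FirstOrder.Language.Term.var (Sum.inl none))).iff
          ((FirstOrder.Language.Term.bdEqual (FirstOrder.Language.Term.var (Sum.inr 0))
              (FirstOrder.Language.Term.var (Sum.inl (some 0)))) ⊔
            (FirstOrder.Language.Term.bdEqual (FirstOrder.Language.Term.var (Sum.inr 0))
              (FirstOrder.Language.Term.var (Sum.inl (some 1))))))
    refine ⟨φ, ?_⟩
    ext v
    have h1 : φ.Realize v ↔ ∀ x : M, x ∈ v none ↔ x = v (some 0) ∨ x = v (some 1) := by
      simp only [φ, FirstOrder.Language.Formula.Realize, FirstOrder.Language.BoundedFormula.realize_all,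
        FirstOrder.Language.BoundedFormula.realize_iff, FirstOrder.Language.BoundedFormula.realize_sup,
        FirstOrder.Language.BoundedFormula.realize_rel₂, FirstOrder.Language.BoundedFormula.realize_bdEqual]
      rfl
    change upair (v (some 0)) (v (some 1)) = v none ↔ φ.Realize v
    rw [h1]
    constructor
    · intro h x
      rw [← h, mem_upair]
    · intro h
      refine ZFCModel.extensionality _ _ fun x => ?_
      rw [h, mem_upair]
  exact key.of_empty

theorem definable_upair {α : Type*} {f g : (α → M) → M}
    (hf : (Set.univ : Set M).DefinableFun setLang f)
    (hg : (Set.univ : Set M).DefinableFun setLang g) :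
    (Set.univ : Set M).DefinableFun setLang fun v => upair (f v) (g v) := by
  have hm : (Set.univ : Set M).DefinableMap setLang fun v => ![f v, g v] := by
    intro i
    fin_cases i
    · exact hf
    · exact hg
  exact Set.DefinableFun.comp hm isFunctional_upair

theorem definable_opair {α : Type*} {f g : (α → M) → M}
    (hf : (Set.univ : Set M).DefinableFun setLang f)
    (hg : (Set.univ : Set M).DefinableFun setLang g) :
    (Set.univ : Set M).DefinableFun setLang fun v => opair (f v) (g v) :=
  definable_upair (definable_upair hf hf) (definable_upair hf hg)

theorem isFunctional_opair : IsFunctional fun v : Fin 2 → M => opair (v 0) (v 1) :=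
  definable_opair (Set.DefinableFun.proj setLang) (Set.DefinableFun.proj setLang)

theorem mem_prod (a b z : M) :
    z ∈ prod a b ↔ ∃ x y : M, x ∈ a ∧ y ∈ b ∧ z = opair x y := by
  refine mem_collect ?_ z
  have hC : IsClass {z : M | ∃ x y : M, x ∈ a ∧ y ∈ b ∧ z = opair x y} := by
    have p : ∀ i : Fin 1 ⊕ Fin 2,
        (Set.univ : Set M).DefinableFun setLang fun v : Fin 1 ⊕ Fin 2 → M => v i :=
      fun i => Set.DefinableFun.proj setLang
    have c : ∀ d : M, (Set.univ : Set M).DefinableFun setLang fun _ : Fin 1 ⊕ Fin 2 → M => d :=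
      fun d => setLang.definableFun_const _ (Set.mem_univ d)
    have h := ((definable_mem (p (Sum.inr 0)) (c a)).inter
      ((definable_mem (p (Sum.inr 1)) (c b)).inter
        (Set.DefinableFun.ofPred_eq (p (Sum.inl 0))
          (definable_opair (p (Sum.inr 0)) (p (Sum.inr 1)))))).exists_of_finite
    unfold IsClass Set.Definable₁
    refine (congrArg _ (Set.ext fun v => ?_)).mpr h
    constructor
    · rintro ⟨x, y, hx, hy, hz⟩
      exact ⟨![x, y], hx, hy, hz⟩
    · rintro ⟨u, hx, hy, hz⟩
      exact ⟨u 0, u 1, hx, hy, hz⟩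
  obtain ⟨s, hs⟩ := ZFCModel.separation _ hC (power (power (cup a b)))
  refine ⟨s, fun z => (hs z).trans ⟨fun h => h.2, fun h => ⟨?_, h⟩⟩⟩
  obtain ⟨x, y, hx, hy, rfl⟩ := h
  rw [mem_power]
  intro u hu
  rw [mem_power]
  intro t ht
  rw [mem_cup]
  rcases (mem_upair _ _ _).1 hu with rfl | rfl
  · rcases (mem_upair _ _ _).1 ht with rfl | rfl <;> exact Or.inl hx
  · rcases (mem_upair _ _ _).1 ht with rfl | rfl
    · exact Or.inl hx
    · exact Or.inr hy

theorem mem_omega (n : M) : n ∈ (omega : M) ↔ ∀ a : M, IsInductive a → n ∈ a := by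
  refine mem_collect ?_ n
  have hI : (∅ : Set M).Definable setLang {v : Fin 1 ⊕ Fin 1 → M |
      IsInductive (v (Sum.inr 0))} := by
    rw [Set.empty_definable_iff]
    let r : setLang.Relations 2 := MemRel.mem
    let A : setLang.Term ((Fin 1 ⊕ Fin 1) ⊕ Fin 2) :=
      FirstOrder.Language.Term.var (Sum.inl (Sum.inr 0))
    let φ : setLang.BoundedFormula (Fin 1 ⊕ Fin 1) 0 :=
      (FirstOrder.Language.BoundedFormula.all (FirstOrder.Language.BoundedFormula.imp
        (FirstOrder.Language.BoundedFormula.all (FirstOrder.Language.BoundedFormula.not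
          (r.boundedFormula₂ (FirstOrder.Language.Term.var (Sum.inr 1))
            (FirstOrder.Language.Term.var (Sum.inr 0)))))
        (r.boundedFormula₂ (FirstOrder.Language.Term.var (Sum.inr 0))
          (FirstOrder.Language.Term.var (Sum.inl (Sum.inr 0)))))) ⊓
      (FirstOrder.Language.BoundedFormula.all (FirstOrder.Language.BoundedFormula.all
        (FirstOrder.Language.BoundedFormula.imp
          (r.boundedFormula₂ (FirstOrder.Language.Term.var (Sum.inr 0)) A)
          (FirstOrder.Language.BoundedFormula.imp
            (FirstOrder.Language.BoundedFormula.all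
              (FirstOrder.Language.BoundedFormula.iff
                (r.boundedFormula₂ (FirstOrder.Language.Term.var (Sum.inr 2))
                  (FirstOrder.Language.Term.var (Sum.inr 1)))
                ((r.boundedFormula₂ (FirstOrder.Language.Term.var (Sum.inr 2))
                  (FirstOrder.Language.Term.var (Sum.inr 0))) ⊔
                (FirstOrder.Language.Term.bdEqual (FirstOrder.Language.Term.var (Sum.inr 2))
                  (FirstOrder.Language.Term.var (Sum.inr 0))))))
            (r.boundedFormula₂ (FirstOrder.Language.Term.var (Sum.inr 1)) A)))))
    refine ⟨φ, Set.ext fun v => ?_⟩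
    change IsInductive (v (Sum.inr 0)) ↔ FirstOrder.Language.BoundedFormula.Realize φ v _
    simp only [φ, FirstOrder.Language.BoundedFormula.realize_all,
      FirstOrder.Language.BoundedFormula.realize_iff,
      FirstOrder.Language.BoundedFormula.realize_imp,
      FirstOrder.Language.BoundedFormula.realize_not,
      FirstOrder.Language.BoundedFormula.realize_inf,
      FirstOrder.Language.BoundedFormula.realize_sup,
      FirstOrder.Language.BoundedFormula.realize_rel₂,
      FirstOrder.Language.BoundedFormula.realize_bdEqual]
    constructor
    · exact fun h => ⟨h.1, h.2⟩
    · exact fun h => ⟨h.1, h.2⟩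
  have hC : IsClass {n : M | ∀ a : M, IsInductive a → n ∈ a} := by
    have p : ∀ i : Fin 1 ⊕ Fin 1,
        (Set.univ : Set M).DefinableFun setLang fun v : Fin 1 ⊕ Fin 1 → M => v i :=
      fun i => Set.DefinableFun.proj setLang
    have h := ((hI.mono (Set.empty_subset Set.univ)).compl.union
      (definable_mem (p (Sum.inl 0)) (p (Sum.inr 0)))).forall_of_finite
    unfold IsClass Set.Definable₁
    refine (congrArg _ (Set.ext fun v => ?_)).mpr h
    constructor
    · intro hv u
      exact or_iff_not_imp_left.2 fun hu => hv (u 0) (not_not.1 hu)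
    · intro hv a ha
      exact (hv fun _ => a).resolve_left fun hn => hn ha
  obtain ⟨d, ⟨e, hed, he⟩, hd⟩ := ZFCModel.infinity (M := M)
  have hdi : IsInductive d := by
    refine ⟨fun e' he' => ?_, fun x y hx hy => ?_⟩
    · rwa [ZFCModel.extensionality e' e fun x => iff_of_false (he' x) (he x)]
    · obtain ⟨y', hy', hy''⟩ := hd x hx
      rwa [ZFCModel.extensionality y y' fun x => (hy x).trans (hy'' x).symm]
  obtain ⟨s, hs⟩ := ZFCModel.separation _ hC d
  exact ⟨s, fun n => (hs n).trans ⟨fun h => h.2, fun h => ⟨h d hdi, h⟩⟩⟩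

end GroundModel

/-! ## Realizability algebras -/

/-- The operations of a realizability algebra, which live in the ground model `M`: the sets `Lam`
of terms, `Stk` of stacks and `Prc` of processes are elements of `M`, and so are the graphs of the
operations. -/
structure RealizabilityOps (M : Type*) [Membership M M] [ZFCModel M] where
  /-- The set `Λ` of terms. -/
  Lam : M
  /-- The set `Π` of stacks. -/
  Stk : M
  /-- The set `Λ ⋆ Π` of processes. -/
  Prc : M
  /-- Application `(ξ)η`. -/
  app : Elts Lam → Elts Lam → Elts Lam
  /-- Push `ξ · π`. -/
  push : Elts Lam → Elts Stk → Elts Stk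
  /-- The process `ξ ⋆ π`. -/
  star : Elts Lam → Elts Stk → Elts Prc
  /-- The continuation `k_π`. -/
  cont : Elts Stk → Elts Lam
  B : Elts Lam
  C : Elts Lam
  I : Elts Lam
  K : Elts Lam
  W : Elts Lam
  cc : Elts Lam
  app_internal : ∃ g : M, ∀ z : M, z ∈ g ↔
    ∃ (ξ : Elts Lam) (η : Elts Lam), z = opair (opair ξ.1 η.1) (app ξ η).1
  push_internal : ∃ g : M, ∀ z : M, z ∈ g ↔
    ∃ (ξ : Elts Lam) (π : Elts Stk), z = opair (opair ξ.1 π.1) (push ξ π).1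
  star_internal : ∃ g : M, ∀ z : M, z ∈ g ↔
    ∃ (ξ : Elts Lam) (π : Elts Stk), z = opair (opair ξ.1 π.1) (star ξ π).1
  cont_internal : ∃ g : M, ∀ z : M, z ∈ g ↔ ∃ π : Elts Stk, z = opair π.1 (cont π).1

/-- Execution `≻`: the least reflexive and transitive relation on processes that contains the
evaluation rules of the instructions. -/
inductive Exec {M : Type*} [Membership M M] [ZFCModel M] (A : RealizabilityOps M) :
    Elts A.Prc → Elts A.Prc → Prop
  | refl (p) : Exec A p p
  | trans {p q r} : Exec A p q → Exec A q r → Exec A p r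
  | app (ξ η π) : Exec A (A.star (A.app ξ η) π) (A.star ξ (A.push η π))
  | I (ξ π) : Exec A (A.star A.I (A.push ξ π)) (A.star ξ π)
  | K (ξ η π) : Exec A (A.star A.K (A.push ξ (A.push η π))) (A.star ξ π)
  | W (ξ η π) :
      Exec A (A.star A.W (A.push ξ (A.push η π))) (A.star ξ (A.push η (A.push η π)))
  | C (ξ η ζ π) :
      Exec A (A.star A.C (A.push ξ (A.push η (A.push ζ π)))) (A.star ξ (A.push ζ (A.push η π)))
  | B (ξ η ζ π) :
      Exec A (A.star A.B (A.push ξ (A.push η (A.push ζ π)))) (A.star ξ (A.push (A.app η ζ) π))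
  | cc (ξ π) : Exec A (A.star A.cc (A.push ξ π)) (A.star ξ (A.push (A.cont π) π))
  | cont (ξ π ϖ) : Exec A (A.star (A.cont π) (A.push ξ ϖ)) (A.star ξ π)

/-- A realizability algebra in the ground model `M`: the operations, a set `pole` (written `⊥⊥`) of
processes that is saturated for execution, and a set `QP` of proof-like terms that contains the
instructions and is closed under application. Both sets are elements of `M`. -/
structure RealizabilityAlgebra (M : Type*) [Membership M M] [ZFCModel M]
    extends RealizabilityOps M where
  pole : M
  pole_subset : ∀ p : M, p ∈ pole → p ∈ Prc
  pole_saturated : ∀ p q : Elts Prc, Exec toRealizabilityOps p q → q.1 ∈ pole → p.1 ∈ pole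
  QP : M
  QP_subset : ∀ ξ : M, ξ ∈ QP → ξ ∈ Lam
  B_mem : B.1 ∈ QP
  C_mem : C.1 ∈ QP
  I_mem : I.1 ∈ QP
  K_mem : K.1 ∈ QP
  W_mem : W.1 ∈ QP
  cc_mem : cc.1 ∈ QP
  app_mem : ∀ ξ η : Elts Lam, ξ.1 ∈ QP → η.1 ∈ QP → (app ξ η).1 ∈ QP

/-! ## The language of ZF_ε -/

/-- The terms of the language: individual variables, named by natural numbers, and function
symbols, one for each functional of the ground model. -/
inductive LTerm (M : Type*) [Membership M M] : Type _
  | var : ℕ → LTerm M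
  | fn : (n : ℕ) → (f : (Fin n → M) → M) → IsFunctional f → (Fin n → LTerm M) → LTerm M

/-- Formulas of ZF_ε over the ground model `M`, together with the two usual extensions: the
conditional formula `t = u ↪ F` and the quantifier `∀ x^{ℷX} F`, for `X` an individual. -/
inductive Fml (M : Type*) [Membership M M] : Type _
  | top : Fml M
  | bot : Fml M
  /-- `t ε̸ u` -/
  | neps : LTerm M → LTerm M → Fml M
  /-- `t ∉ u` -/
  | nmem : LTerm M → LTerm M → Fml M
  /-- `t ⊂ u` -/
  | sub : LTerm M → LTerm M → Fml M
  | imp : Fml M → Fml M → Fml M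
  | all : ℕ → Fml M → Fml M
  /-- `t = u ↪ F` -/
  | eqImp : LTerm M → LTerm M → Fml M → Fml M
  /-- `∀ x^{ℷX} F` -/
  | allGimel : ℕ → M → Fml M → Fml M

/-- The value of a term; function symbols are interpreted as in the ground model. -/
def LTerm.val {M : Type*} [Membership M M] (e : ℕ → M) : LTerm M → M
  | .var n => e n
  | .fn _ f _ t => f fun i => (t i).val e

/-! ## The realizability model -/

namespace RealizabilityAlgebra

variable {M : Type*} [Membership M M] [ZFCModel M] (A : RealizabilityAlgebra M)

/-- `A` is coherent: no proof-like term puts every process in the pole. -/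
def Coherent : Prop :=
  ∀ θ : Elts A.Lam, θ.1 ∈ A.QP → ∃ π : Elts A.Stk, ¬ (A.star θ π).1 ∈ A.pole

/-- `ξ ⊩ F` for a formula `F` with truth value `‖F‖ = X`. -/
def Forces (ξ : Elts A.Lam) (X : Set (Elts A.Stk)) : Prop :=
  ∀ π : Elts A.Stk, π ∈ X → (A.star ξ π).1 ∈ A.pole

/-- The elements `S`, `N` of `M` tabulate the truth values `‖a ⊂ b‖`, `‖a ∉ b‖`, for `a`, `b` in
the transitive set `D`, as the sets of all `π` with `((a, b), π) ∈ S`, `((a, b), π) ∈ N`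
respectively. That is, they obey the two recursion equations
* `‖a ⊂ b‖ = {ξ · π | (c, π) ∈ a, ξ ⊩ c ∉ b}`,
* `‖a ∉ b‖ = {ξ · ξ' · π | (c, π) ∈ b, ξ ⊩ a ⊂ c, ξ' ⊩ c ⊂ a}`. -/
def IsTable (D S N : M) : Prop :=
  IsTrans D ∧
  (∀ (a b : M) (ϖ : Elts A.Stk), a ∈ D → b ∈ D → (opair (opair a b) ϖ.1 ∈ S ↔
    ∃ (c : M) (ξ : Elts A.Lam) (π : Elts A.Stk), ϖ = A.push ξ π ∧ opair c π.1 ∈ a ∧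
      A.Forces ξ {ρ | opair (opair c b) ρ.1 ∈ N})) ∧
  (∀ (a b : M) (ϖ : Elts A.Stk), a ∈ D → b ∈ D → (opair (opair a b) ϖ.1 ∈ N ↔
    ∃ (c : M) (ξ ξ' : Elts A.Lam) (π : Elts A.Stk), ϖ = A.push ξ (A.push ξ' π) ∧
      opair c π.1 ∈ b ∧ A.Forces ξ {ρ | opair (opair a c) ρ.1 ∈ S} ∧
      A.Forces ξ' {ρ | opair (opair c a) ρ.1 ∈ S}))

/-- `‖a ε̸ b‖`. -/
def tvNeps (a b : M) : Set (Elts A.Stk) := {π | opair a π.1 ∈ b}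

/-- `‖a ⊂ b‖`, defined in `M` by well-founded recursion, simultaneously with `‖a ∉ b‖`. -/
def tvSub (a b : M) : Set (Elts A.Stk) :=
  {π | ∃ D S N : M, A.IsTable D S N ∧ a ∈ D ∧ b ∈ D ∧ opair (opair a b) π.1 ∈ S}

/-- `‖a ∉ b‖`, defined in `M` by well-founded recursion, simultaneously with `‖a ⊂ b‖`. -/
def tvNmem (a b : M) : Set (Elts A.Stk) :=
  {π | ∃ D S N : M, A.IsTable D S N ∧ a ∈ D ∧ b ∈ D ∧ opair (opair a b) π.1 ∈ N}

/-- The truth value `‖F‖` of the formula `F`, its free variables being replaced by the parameters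
that the valuation `e` gives them. -/
def tv : Fml M → (ℕ → M) → Set (Elts A.Stk)
  | .top, _ => ∅
  | .bot, _ => Set.univ
  | .neps t u, e => A.tvNeps (t.val e) (u.val e)
  | .nmem t u, e => A.tvNmem (t.val e) (u.val e)
  | .sub t u, e => A.tvSub (t.val e) (u.val e)
  | .imp F G, e => {ϖ | ∃ (ξ : Elts A.Lam) (π : Elts A.Stk),
      ϖ = A.push ξ π ∧ A.Forces ξ (tv F e) ∧ π ∈ tv G e}
  | .all x F, e => {π | ∃ a : M, π ∈ tv F (Function.update e x a)}
  | .eqImp t u F, e => {π | t.val e = u.val e ∧ π ∈ tv F e}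
  | .allGimel x X F, e => {π | ∃ a : M, a ∈ X ∧ π ∈ tv F (Function.update e x a)}

/-- The realizability model of `A` realizes the closed formula `F`: some proof-like term `θ`
realizes `F`. (The truth value of a closed formula does not depend on the valuation.) -/
def Realizes (F : Fml M) : Prop :=
  ∃ θ : Elts A.Lam, θ.1 ∈ A.QP ∧ ∀ e : ℕ → M, A.Forces θ (A.tv F e)

/-- The individual `ℷX = X × Π`. -/
noncomputable def gimel (X : M) : M := prod X A.Stk

/-- The individual `Λ ∪ Π ∪ ℕ`; its cardinal is the cardinal of the algebra. -/
noncomputable def base : M := cup (cup A.Lam A.Stk) omega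

end RealizabilityAlgebra

/-! ## Formulas expressing well-ordering -/

namespace LTerm

variable {M : Type*} [Membership M M]

/-- The constant symbol (parameter) `a`. -/
def const (a : M) : LTerm M := .fn 0 (fun _ => a) (isFunctional_const a) ![]

/-- The term `(t, u)`: the ordered pair, as a function symbol. -/
noncomputable def pair [ZFCModel M] (t u : LTerm M) : LTerm M :=
  .fn 2 (fun v => opair (v 0) (v 1)) isFunctional_opair ![t, u]

end LTerm

namespace Fml

variable {M : Type*} [Membership M M]

/-- `¬ F` is `F → ⊥`. -/
def neg (F : Fml M) : Fml M := imp F bot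

/-- `t ε u` is `¬ t ε̸ u`. -/
def eps (t u : LTerm M) : Fml M := neg (neps t u)

/-- `t ≠ u` is `t = u ↪ ⊥`. -/
def ne (t u : LTerm M) : Fml M := eqImp t u bot

/-- Leibniz equality `t = u` is `∀ z (t ε̸ z → u ε̸ z)`. The bound variable is `x₀`, which must not
occur in `t`, `u`. -/
def eq (t u : LTerm M) : Fml M := all 0 (imp (neps t (.var 0)) (neps u (.var 0)))

/-- `A₁, …, Aₙ → B`. -/
def imps (l : List (Fml M)) (F : Fml M) : Fml M := l.foldr imp F

/-- `∃ x {A₁, …, Aₙ}` is `¬ ∀ x (A₁, …, Aₙ → ⊥)`. -/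
def ex (x : ℕ) (l : List (Fml M)) : Fml M := neg (all x (imps l bot))

/-- `∃ x^{ℷX} {A₁, …, Aₙ}` is `¬ ∀ x^{ℷX} (A₁, …, Aₙ → ⊥)`. -/
def exGimel (x : ℕ) (X : M) (l : List (Fml M)) : Fml M := neg (allGimel x X (imps l bot))

/-- `A₁ ∧ … ∧ Aₙ` is `(A₁, …, Aₙ → ⊥) → ⊥`. -/
def conj (l : List (Fml M)) : Fml M := neg (imps l bot)

/-- `A₁ ∨ … ∨ Aₙ` is `¬ A₁, …, ¬ Aₙ → ⊥`. -/
def disj (l : List (Fml M)) : Fml M := imps (l.map neg) bot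

/-- `(t, u) ε r`. -/
noncomputable def rel [ZFCModel M] (r t u : LTerm M) : Fml M := eps (LTerm.pair t u) r

/-- `r` is a strict well ordering of the individual `E` (with its `ε`-elements and Leibniz
equality): writing `x < y` for `(x, y) ε r`, on the `ε`-elements of `E` the relation `<` is
irreflexive, transitive and total, and every individual `X` which has some `ε`-element in common
with `E` has a `<`-minimal one. The bound variables are `x₀, …, x₄`; they must not occur in
`r`, `E`. -/
noncomputable def isWellOrder [ZFCModel M] (r E : LTerm M) : Fml M :=
  conj [
    all 1 (imps [eps (.var 1) E] (neg (rel r (.var 1) (.var 1)))),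
    all 1 (all 2 (all 3 (imps [eps (.var 1) E, eps (.var 2) E, eps (.var 3) E,
      rel r (.var 1) (.var 2), rel r (.var 2) (.var 3)] (rel r (.var 1) (.var 3))))),
    all 1 (all 2 (imps [eps (.var 1) E, eps (.var 2) E]
      (disj [rel r (.var 1) (.var 2), rel r (.var 2) (.var 1), eq (.var 1) (.var 2)]))),
    all 4 (imp (ex 1 [eps (.var 1) E, eps (.var 1) (.var 4)])
      (ex 1 [eps (.var 1) E, eps (.var 1) (.var 4),
        all 2 (imps [eps (.var 2) E, eps (.var 2) (.var 4)] (neg (rel r (.var 2) (.var 1))))]))]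

/-- `E` cannot be well ordered: no individual `r` is a strict well ordering of `E`. The bound
variables are `x₀, …, x₅`; they must not occur in `E`. -/
noncomputable def notWellOrderable [ZFCModel M] (E : LTerm M) : Fml M :=
  neg (ex 5 [isWellOrder (.var 5) E])

end Fml

end ClassicalRealizability

/-! If a formula is not realized, then it fails in some classical model built from the truth values.
A statement is a family of truth values indexed by the valuations of names in `M`; the families with
one uniform proof-like realizer form a theory. Zorn's lemma and Henkin witnesses extend it to a
complete theory `S` that omits the given formula (`exists_isHenkin`). Every function of the ground
model then acts on names (`exists_name`), and the sets of valuations of value `1` in `S` form a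
filter for which Leibniz equality is eventual equality. An `i` in `ℷ2` other than `0` and `1` cuts
the valuations into two pieces, neither of which belongs to the filter.

Suppose that `ℷκ₊` is well ordered. Glue along `i`: let `α` be `ℷκ₊` where `i = 1` and `ℷ{0}` where
`i = 0`, and let `β` be the reverse. Both lie in `ℷκ₊`, so the well ordering compares them: a
partial injection from `α` to `β` is onto `β` or defined on all of `α` (`matches_iff_isNext`,
`matches_left_or_right`). In the first case, where `i = 0`, a functional relation with the single
argument `0` takes every value in `κ₊`.

This is absurd by a non-extensional choice principle combined with Cantor's diagonal
(`IsHenkin.eventually_of_surjective`). A stack that belongs to the truth value of `¬ P(x, y)` can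
serve as an index for `y`, so if `P(x, y)` holds for some `y`, it holds for some `f(x, k)` with `k`
in `ℷΠ`. There are at most `κ` stacks, so some subset `d` of `κ` differs from all `f(0, k)`
(`exists_choice_avoiding`). Hence `i = 1`; the second case, treated with the inverse relation, gives
`i = 0`. Both are excluded. -/

namespace ClassicalRealizability

universe u

/-! ### Combinatory logic of families of truth values -/

namespace RealizabilityAlgebra

variable {M : Type u} [Membership M M] [ZFCModel M] (A : RealizabilityAlgebra M) {I : Type u}

/-- The truth value of an implication. -/
def impTV (X Y : Set (Elts A.Stk)) : Set (Elts A.Stk) :=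
  {ϖ | ∃ (ξ : Elts A.Lam) (π : Elts A.Stk), ϖ = A.push ξ π ∧ A.Forces ξ X ∧ π ∈ Y}

/-- Pointwise implication of families of truth values. -/
def imp (P Q : I → Set (Elts A.Stk)) : I → Set (Elts A.Stk) := fun i => A.impTV (P i) (Q i)

/-- A family of truth values is valid if some proof-like term realizes all its members. -/
def Valid (P : I → Set (Elts A.Stk)) : Prop :=
  ∃ θ : Elts A.Lam, θ.1 ∈ A.QP ∧ ∀ i, A.Forces θ (P i)

variable {A}

theorem forces_impTV {ξ : Elts A.Lam} {X Y : Set (Elts A.Stk)} :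
    A.Forces ξ (A.impTV X Y) ↔
      ∀ η π, A.Forces η X → π ∈ Y → (A.star ξ (A.push η π)).1 ∈ A.pole :=
  ⟨fun h η π hη hπ => h _ ⟨η, π, rfl, hη, hπ⟩, by
    rintro h _ ⟨η, π, rfl, hη, hπ⟩
    exact h η π hη hπ⟩

theorem forces_app {ξ η : Elts A.Lam} {X Y : Set (Elts A.Stk)} (hξ : A.Forces ξ (A.impTV X Y))
    (hη : A.Forces η X) : A.Forces (A.app ξ η) Y := fun π hπ =>
  A.pole_saturated _ _ (.app ξ η π) (forces_impTV.1 hξ η π hη hπ)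

theorem valid_mp {P Q : I → Set (Elts A.Stk)} (h : A.Valid (A.imp P Q)) (hP : A.Valid P) :
    A.Valid Q := by
  obtain ⟨θ, hθ, h⟩ := h
  obtain ⟨η, hη, h'⟩ := hP
  exact ⟨A.app θ η, A.app_mem _ _ hθ hη, fun i => forces_app (h i) (h' i)⟩

theorem valid_of_subset {P Q : I → Set (Elts A.Stk)} (h : ∀ i, Q i ⊆ P i) :
    A.Valid (A.imp P Q) :=
  ⟨A.I, A.I_mem, fun i => forces_impTV.2 fun ξ π hξ hπ =>
    A.pole_saturated _ _ (.I ξ π) (hξ π (h i hπ))⟩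

theorem valid_k (P Q : I → Set (Elts A.Stk)) : A.Valid (A.imp P (A.imp Q P)) := by
  refine ⟨A.K, A.K_mem, fun i => forces_impTV.2 ?_⟩
  rintro ξ _ hξ ⟨η, π, rfl, -, hπ⟩
  exact A.pole_saturated _ _ (.K ξ η π) (hξ π hπ)

/-- The combinator `S` is compiled from the instructions as `B(BW)(BBC)`. -/
theorem valid_s (P Q R : I → Set (Elts A.Stk)) :
    A.Valid (A.imp (A.imp P (A.imp Q R)) (A.imp (A.imp P Q) (A.imp P R))) := by
  let BW := A.app A.B A.W
  let BBC := A.app (A.app A.B A.B) A.C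
  refine ⟨A.app (A.app A.B BW) BBC, A.app_mem _ _ (A.app_mem _ _ A.B_mem (A.app_mem _ _ A.B_mem
    A.W_mem)) (A.app_mem _ _ (A.app_mem _ _ A.B_mem A.B_mem) A.C_mem),
    fun i => forces_impTV.2 ?_⟩
  rintro f _ hf ⟨g, _, rfl, hg, ⟨x, π, rfl, hx, hπ⟩⟩
  have h : (A.star f (A.push x (A.push (A.app g x) π))).1 ∈ A.pole :=
    hf _ ⟨x, _, rfl, hx, _, π, rfl, forces_app hg hx, hπ⟩
  refine A.pole_saturated _ _ ?_ h
  refine .trans (.app _ _ _) <| .trans (.app _ _ _) <| .trans (.B _ _ _ _) <|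
    .trans (.app _ _ _) <| .trans (.B _ _ _ _) <| .trans (.W _ _ _) <| .trans (.app _ _ _) <|
    .trans (.app _ _ _) <| .trans (.app _ _ _) <| .trans (.app _ _ _) <|
    .trans (.B _ _ _ _) <| .trans (.B _ _ _ _) <| .trans (.app _ _ _) (.C _ _ _ _)

/-- For `π` in `‖P‖`, the continuation `k_π` realizes `P → Q` whatever `Q` is, since it discards the
current stack and restores `π`. -/
theorem valid_peirce (P Q : I → Set (Elts A.Stk)) :
    A.Valid (A.imp (A.imp (A.imp P Q) P) P) := by
  refine ⟨A.cc, A.cc_mem, fun i => forces_impTV.2 fun ξ π hξ hπ =>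
    A.pole_saturated _ _ (.cc ξ π) (hξ _ ⟨_, π, rfl, ?_, hπ⟩)⟩
  exact forces_impTV.2 fun η ϖ hη _ => A.pole_saturated _ _ (.cont η π ϖ) (hη π hπ)

/-- A theory contains the valid families and is closed under modus ponens. -/
structure IsTheory (T : Set (I → Set (Elts A.Stk))) : Prop where
  valid : ∀ {P}, A.Valid P → P ∈ T
  mp : ∀ {P Q}, A.imp P Q ∈ T → P ∈ T → Q ∈ T

/-- A complete theory commutes with implication and absurdity. -/
structure IsComplete (T : Set (I → Set (Elts A.Stk))) : Prop extends IsTheory T where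
  imp_mem : ∀ {P Q}, (P ∈ T → Q ∈ T) → A.imp P Q ∈ T
  bot : (fun _ => Set.univ) ∉ T

/-! ### Deduction theorem and complete extensions of theories -/

variable {T : Set (I → Set (Elts A.Stk))} {P Q R : I → Set (Elts A.Stk)}

theorem IsTheory.k (hT : IsTheory T) (P : I → Set (Elts A.Stk)) (hQ : Q ∈ T) : A.imp P Q ∈ T :=
  hT.mp (hT.valid (valid_k Q P)) hQ

theorem IsTheory.refl (hT : IsTheory T) (P : I → Set (Elts A.Stk)) : A.imp P P ∈ T :=
  hT.valid (valid_of_subset fun _ => subset_rfl)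

theorem IsTheory.of_subset (hT : IsTheory T) (h : ∀ i, Q i ⊆ P i) (hP : P ∈ T) : Q ∈ T :=
  hT.mp (hT.valid (valid_of_subset h)) hP

/-- The deduction theorem: the consequences of `T` and `P` are again a theory. It spares writing
realizers by hand. -/
theorem IsTheory.adjoin (hT : IsTheory T) (P : I → Set (Elts A.Stk)) :
    IsTheory {Q | A.imp P Q ∈ T} where
  valid h := hT.k _ (hT.valid h)
  mp h h' := hT.mp (hT.mp (hT.valid (valid_s _ _ _)) h) h'

/-- A theory maximal among those that omit `P` is complete: adjoining any `Q` outside it makes `P`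
derivable, and Peirce's law does the rest. -/
theorem IsTheory.exists_isComplete (hT : IsTheory T) (hP : P ∉ T) :
    ∃ S, T ⊆ S ∧ P ∉ S ∧ IsComplete S := by
  obtain ⟨S, hTS, hS⟩ := zorn_subset_nonempty {S | IsTheory S ∧ P ∉ S} (by
    rintro c hc hchain ⟨S₀, hS₀⟩
    refine ⟨⋃₀ c, ⟨⟨fun h => ⟨S₀, hS₀, (hc hS₀).1.valid h⟩, ?_⟩, ?_⟩,
      fun s hs => Set.subset_sUnion_of_mem hs⟩
    · rintro Q R ⟨S₁, h₁, hQR⟩ ⟨S₂, h₂, hQ⟩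
      rcases hchain.total h₁ h₂ with h | h
      · exact ⟨S₂, h₂, (hc h₂).1.mp (h hQR) hQ⟩
      · exact ⟨S₁, h₁, (hc h₁).1.mp hQR (h hQ)⟩
    · rintro ⟨S₁, h₁, h⟩
      exact (hc h₁).2 h) T ⟨hT, hP⟩
  have key : ∀ Q, Q ∉ S → A.imp Q P ∈ S := by
    intro Q hQ
    by_contra h
    exact hQ (hS.2 (y := {R | A.imp Q R ∈ S}) ⟨hS.1.1.adjoin Q, h⟩
      (fun R hR => hS.1.1.k _ hR) (hS.1.1.refl Q))
  refine ⟨S, hTS, hS.1.2, hS.1.1, ?_, ?_⟩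
  · intro Q R h
    by_cases hQ : Q ∈ S
    · exact hS.1.1.k _ (h hQ)
    by_contra hQR
    -- It remains to derive `P` from `P → R`. Composing with `Q → P` gives `Q → R`, and `(Q → R) →
    -- P` is already in `S`.
    refine hS.1.2 (hS.1.1.mp (hS.1.1.valid (valid_peirce P R)) ?_)
    have h₁ := hS.1.1.adjoin (A.imp P R)
    refine h₁.mp (hS.1.1.k _ (key _ hQR)) ?_
    have h₂ := h₁.adjoin Q
    exact h₂.mp (h₁.k _ (hS.1.1.refl _)) (h₂.mp (h₁.k _ (hS.1.1.k _ (key _ hQ))) (h₁.refl Q))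
  · exact fun h => hS.1.2 (hS.1.1.of_subset (fun i => Set.subset_univ _) h)

/-- Replaces syntactic derivations by truth-table reasoning in complete theories. -/
theorem IsTheory.of_complete (hT : IsTheory T)
    (h : ∀ S, T ⊆ S → IsComplete S → P ∈ S) : P ∈ T := by
  by_contra hP
  obtain ⟨S, h₁, h₂, h₃⟩ := hT.exists_isComplete hP
  exact h₂ (h S h₁ h₃)

theorem IsComplete.imp_iff (hT : IsComplete T) : A.imp P Q ∈ T ↔ (P ∈ T → Q ∈ T) :=
  ⟨hT.mp, hT.imp_mem⟩

theorem isTheory_valid : IsTheory {P : I → Set (Elts A.Stk) | A.Valid P} := ⟨id, valid_mp⟩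

/-! ### Names and Henkin axioms -/

/-- Names of individuals: variables, and witnesses for universally quantified families. -/
inductive Name (A : RealizabilityAlgebra M) : Type u
  | base : ℕ → Name A
  | sk : ((ℕ → M) → M → Set (Elts A.Stk)) → (ℕ → Name A) → Name A

/-- The rank of a name. -/
noncomputable def Name.rank : Name A → Ordinal.{u}
  | .base _ => 0
  | .sk _ v => ⨆ n, Order.succ (v n).rank

theorem Name.rank_lt (P : (ℕ → M) → M → Set (Elts A.Stk)) (v : ℕ → Name A) (n : ℕ) :
    (v n).rank < (Name.sk P v).rank := by
  rw [Name.rank]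
  exact (Order.lt_succ _).trans_le (Ordinal.le_iSup (fun n => Order.succ (v n).rank) n)

/-- The Henkin axiom of a name. -/
def henkin : Name A → (Name A → M) → Set (Elts A.Stk)
  | .base _ => fun _ => ∅
  | .sk P v => A.imp (fun e => P (fun n => e (v n)) (e (.sk P v)))
      (fun e => ⋃ a, P (fun n => e (v n)) a)

/-- The family `P` does not depend on the value of the name `c`. -/
def Indep (c : Name A) (P : (Name A → M) → Set (Elts A.Stk)) : Prop :=
  open Classical in ∀ e a, P (Function.update e c a) = P e

/-- The Henkin axiom of `d` reads only `d` and the arguments of `d`, and the latter have rank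
strictly below that of `d`. -/
theorem indep_henkin {c d : Name A} (hcd : d ≠ c) (h : d.rank ≤ c.rank) :
    Indep c (henkin d) := by
  classical
  intro e a
  cases d with
  | base n => rfl
  | sk P v =>
    have h' : ∀ n, v n ≠ c := fun n hn => by
      have := Name.rank_lt P v n
      rw [hn] at this
      exact absurd (this.trans_le h) (lt_irrefl _)
    simp only [henkin, imp, Function.update_of_ne hcd, Function.update_of_ne (h' _)]

/-- Universal quantification over the values of the name `c`. -/
def allName (c : Name A) (P : (Name A → M) → Set (Elts A.Stk)) :
    (Name A → M) → Set (Elts A.Stk) :=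
  open Classical in fun e => ⋃ a, P (Function.update e c a)

theorem Indep.allName {c : Name A} {P : (Name A → M) → Set (Elts A.Stk)} (h : Indep c P)
    (e : Name A → M) : allName c P e = P e := by
  have : Nonempty M := ⟨e c⟩
  simp only [RealizabilityAlgebra.allName, h e, Set.iUnion_const]

theorem Valid.allName {c : Name A} {P : (Name A → M) → Set (Elts A.Stk)} (h : A.Valid P) :
    A.Valid (allName c P) := by
  obtain ⟨θ, hθ, h⟩ := h
  refine ⟨θ, hθ, fun e π hπ => ?_⟩
  obtain ⟨a, ha⟩ := Set.mem_iUnion.1 hπ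
  exact h _ π ha

theorem isTheory_allName {T : Set ((Name A → M) → Set (Elts A.Stk))} (hT : IsTheory T)
    (c : Name A) : IsTheory {P | allName c P ∈ T} where
  valid h := hT.valid h.allName
  mp {P Q} h h' := by
    refine hT.mp (hT.of_subset (fun e => ?_) h) h'
    rintro _ ⟨ξ, π, rfl, hξ, hπ⟩
    obtain ⟨a, ha⟩ := Set.mem_iUnion.1 hπ
    exact Set.mem_iUnion.2 ⟨a, ξ, π, rfl, fun ρ hρ => hξ ρ (Set.mem_iUnion.2 ⟨a, hρ⟩), ha⟩

/-- The drinker's argument. If `X` fails, the axiom `P(c) → ∀ a P(a)` fails for every value of `c`,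
so `P(c)` holds for every value; then `∀ a P(a)` holds and the axiom is true after all. -/
theorem henkin_elim {T : Set ((Name A → M) → Set (Elts A.Stk))} (hT : IsTheory T) (c : Name A)
    {X : (Name A → M) → Set (Elts A.Stk)} (hX : Indep c X)
    (h : allName c (A.imp (henkin c) X) ∈ T) : X ∈ T := by
  classical
  cases c with
  | base n =>
    refine hT.mp (hT.of_subset (Q := A.imp (henkin (.base n)) X) (fun e => ?_) h)
      (hT.valid ⟨A.I, A.I_mem, fun _ _ h => absurd h (Set.notMem_empty _)⟩)
    refine Set.subset_iUnion_of_subset (e (.base n)) ?_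
    rw [Function.update_eq_self]
  | sk P v =>
    set c := Name.sk P v with hc
    have hv : ∀ n, v n ≠ c := fun n hn => by
      have := Name.rank_lt P v n
      rw [hn] at this
      exact lt_irrefl _ this
    let D := allName c (A.imp (henkin c) X)
    let N := A.imp X fun _ => Set.univ
    let p : (Name A → M) → Set (Elts A.Stk) := fun e => P (fun n => e (v n)) (e c)
    let q : (Name A → M) → Set (Elts A.Stk) := fun e => ⋃ a, P (fun n => e (v n)) a
    have hD : Indep c D := fun e a => by simp [D, allName]
    have hN : Indep c N := fun e a => by simp [N, imp, hX e a]
    have hsub : ∀ e, A.imp (henkin c) X e ⊆ D e := fun e =>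
      Set.subset_iUnion_of_subset (e c) (by rw [Function.update_eq_self])
    have h₁ : A.Valid (A.imp D (A.imp N p)) := by
      refine isTheory_valid.of_complete fun S hS hSc => ?_
      rw [hSc.imp_iff, hSc.imp_iff]
      intro hDS hNS
      have h₂ := hSc.imp_iff.1 (hSc.of_subset hsub hDS)
      by_contra hp
      exact hSc.bot (hSc.mp hNS (h₂ (hSc.imp_mem fun hp' => absurd hp' hp)))
    -- Generalization over `c` keeps the same realizer, because `D` and `N` do not depend on `c`.
    have h₂ : A.Valid (A.imp D (A.imp N q)) := by
      obtain ⟨θ, hθ, h⟩ := h₁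
      refine ⟨θ, hθ, fun e => ?_⟩
      rintro _ ⟨ξ, _, rfl, hξ, η, π, rfl, hη, hπ⟩
      obtain ⟨a, ha⟩ := Set.mem_iUnion.1 hπ
      refine h (Function.update e c a) _ ⟨ξ, _, rfl, ?_, η, π, rfl, ?_, ?_⟩
      · rwa [hD e a]
      · rwa [hN e a]
      · simpa only [p, Function.update_of_ne (hv _), Function.update_self] using ha
    refine hT.of_complete fun S hS hSc => ?_
    by_contra hXS
    have hDS : D ∈ S := hS h
    have hNS : N ∈ S := hSc.imp_mem fun h => absurd h hXS
    have hq := hSc.mp (hSc.mp (hSc.valid h₂) hDS) hNS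
    exact hXS (hSc.mp (hSc.of_subset hsub hDS) (hSc.imp_mem fun _ => hq))

/-- Derivability from a set of assumptions. -/
def Entails (Γ : Set (I → Set (Elts A.Stk))) (P : I → Set (Elts A.Stk)) : Prop :=
  ∀ T, IsTheory T → Γ ⊆ T → P ∈ T

/-- The axioms are eliminated in order of decreasing rank: a name of maximal rank does not occur in
the other axioms, so it may be quantified universally. -/
theorem entails_henkin {X : (Name A → M) → Set (Elts A.Stk)}
    (hX : ∀ P v, Indep (Name.sk P v) X) (s : Finset (Name A))
    (hs : Entails (henkin '' (s : Set (Name A))) X)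
    (hb : ∀ c ∈ s, ∃ P v, c = Name.sk P v) : A.Valid X := by
  classical
  revert hs hb
  refine Finset.induction_on_max_value Name.rank s ?_ ?_
  · exact fun hs _ => hs _ isTheory_valid (by simp)
  · intro c s hc hmax ih hs hb
    refine ih (fun T hT hΓ => ?_) fun d hd => hb d (Finset.mem_insert_of_mem hd)
    obtain ⟨P, v, hPv⟩ := hb c (Finset.mem_insert_self c s)
    refine henkin_elim hT c (hPv ▸ hX P v) ?_
    have h₁ := isTheory_allName hT c
    refine hs _ (h₁.adjoin (henkin c)) ?_
    rintro _ ⟨d, hd, rfl⟩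
    rcases Finset.mem_insert.1 hd with rfl | hd
    · exact h₁.refl _
    · refine h₁.k _ (hT.of_subset (P := henkin d) (fun e => ?_) (hΓ ⟨d, hd, rfl⟩))
      have hdc : d ≠ c := fun h => hc (h ▸ hd)
      rw [(indep_henkin hdc (hmax d hd)).allName]

/-- A Henkin theory is a complete theory that contains the Henkin axioms. -/
structure IsHenkin (S : Set ((Name A → M) → Set (Elts A.Stk))) : Prop extends IsComplete S where
  henkin_mem : ∀ P v, henkin (.sk P v) ∈ S

/-- The theory to complete consists of the consequences of finitely many Henkin axioms. It omits
`F`, since eliminating those axioms would leave one proof-like realizer for all valuations. -/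
theorem exists_isHenkin {F : Fml M} (hF : ¬ A.Realizes F) :
    ∃ S : Set ((Name A → M) → Set (Elts A.Stk)), IsHenkin S ∧
      (fun e => A.tv F fun n => e (.base n)) ∉ S := by
  classical
  let X : (Name A → M) → Set (Elts A.Stk) := fun e => A.tv F fun n => e (.base n)
  let T : Set ((Name A → M) → Set (Elts A.Stk)) :=
    {P | ∃ s : Finset (Name A), (∀ c ∈ s, ∃ P v, c = Name.sk P v) ∧
      Entails (henkin '' (s : Set (Name A))) P}
  have hT : IsTheory T := by
    refine ⟨fun h => ⟨∅, by simp, fun T hT _ => hT.valid h⟩, ?_⟩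
    rintro P Q ⟨s, hs, h⟩ ⟨t, ht, h'⟩
    refine ⟨s ∪ t, fun c hc => (Finset.mem_union.1 hc).elim (hs c) (ht c), fun T hT hΓ => ?_⟩
    rw [Finset.coe_union, Set.image_union, Set.union_subset_iff] at hΓ
    exact hT.mp (h T hT hΓ.1) (h' T hT hΓ.2)
  have hXT : X ∉ T := by
    rintro ⟨s, hs, h⟩
    obtain ⟨θ, hθ, hθ'⟩ := entails_henkin (fun P v e a => by simp [X]) s h hs
    refine hF ⟨θ, hθ, fun e => ?_⟩
    exact hθ' fun c => match c with
      | .base n => e n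
      | .sk _ _ => e 0
  obtain ⟨S, hTS, hXS, hS⟩ := hT.exists_isComplete hXT
  refine ⟨S, ⟨hS, fun P v => hTS ⟨{.sk P v}, fun c hc => ?_, fun T hT hΓ => hΓ (by simp)⟩⟩, hXS⟩
  exact ⟨P, v, Finset.mem_singleton.1 hc⟩

end RealizabilityAlgebra

/-! ### Definable predicates of the ground model -/

section Definability

variable {M : Type u} [Membership M M]

/-- A predicate on tuples of individuals of `M` that is definable with parameters. -/
def Dfn {α : Type*} (p : (α → M) → Prop) : Prop :=
  (Set.univ : Set M).Definable setLang {e | p e}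

/-- A function on tuples of individuals of `M` that is definable with parameters. -/
def DFun {α : Type*} (f : (α → M) → M) : Prop := (Set.univ : Set M).DefinableFun setLang f

theorem DFun.var {α : Type*} (i : α) : DFun fun e : α → M => e i := Set.DefinableFun.proj setLang

theorem DFun.const {α : Type*} (a : M) : DFun fun _ : α → M => a :=
  setLang.definableFun_const _ (Set.mem_univ a)

variable {α β : Type*} {p q : (α → M) → Prop} {f g : (α → M) → M}

theorem Dfn.congr (hp : Dfn p) (h : ∀ e, q e ↔ p e) : Dfn q := by
  rwa [show q = p from funext fun e => propext (h e)]

theorem Dfn.and (hp : Dfn p) (hq : Dfn q) : Dfn fun e => p e ∧ q e := Set.Definable.inter hp hq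

theorem Dfn.or (hp : Dfn p) (hq : Dfn q) : Dfn fun e => p e ∨ q e := Set.Definable.union hp hq

theorem Dfn.not (hp : Dfn p) : Dfn fun e => ¬ p e := Set.Definable.compl hp

theorem Dfn.imp (hp : Dfn p) (hq : Dfn q) : Dfn fun e => p e → q e :=
  (hp.not.or hq).congr fun _ => imp_iff_not_or

theorem Dfn.iff (hp : Dfn p) (hq : Dfn q) : Dfn fun e => p e ↔ q e :=
  ((hp.imp hq).and (hq.imp hp)).congr fun _ => iff_def

theorem Dfn.mem (hf : DFun f) (hg : DFun g) : Dfn fun e => f e ∈ g e := definable_mem hf hg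

theorem Dfn.eq (hf : DFun f) (hg : DFun g) : Dfn fun e => f e = g e := Set.DefinableFun.ofPred_eq hf hg

/-- Variables may be renamed and replaced with parameters. -/
theorem Dfn.subst (hp : Dfn p) (s : α → β ⊕ M) :
    Dfn fun e : β → M => p fun i => Sum.elim e id (s i) := by
  obtain ⟨φ, hφ⟩ := hp
  refine ⟨FirstOrder.Language.BoundedFormula.subst φ fun i =>
    Sum.elim (fun j => FirstOrder.Language.Term.var j)
      (fun a => (setLang.con (⟨a, Set.mem_univ a⟩ : (Set.univ : Set M))).term) (s i), ?_⟩
  ext e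
  have h : (fun i => Sum.elim e id (s i)) ∈ {e | p e} ↔
      φ.Realize fun i => Sum.elim e id (s i) := by
    rw [hφ]
    rfl
  refine h.trans ?_
  change _ ↔ FirstOrder.Language.BoundedFormula.Realize _ _ _
  rw [FirstOrder.Language.BoundedFormula.realize_subst]
  refine iff_of_eq (congrArg (fun v => FirstOrder.Language.BoundedFormula.Realize φ v _)
    (funext fun i => ?_))
  cases s i <;> rfl

/-- The tuple `(a, e₀, e₁, …)`. -/
def cons {X : Type*} (a : X) (e : ℕ → X) : ℕ → X
  | 0 => a
  | n + 1 => e n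

theorem comp_cons {X Y : Type*} (f : X → Y) (a : X) (e : ℕ → X) :
    (fun n => f (cons a e n)) = cons (f a) (fun n => f (e n)) := by
  funext n
  cases n <;> rfl

theorem Dfn.ex {p : (ℕ → M) → M → Prop} (hp : Dfn fun e => p (fun n => e (n + 1)) (e 0)) :
    Dfn fun e => ∃ x, p e x := by
  have h := Set.Definable.preimage_comp
    (fun n => match n with | 0 => Sum.inr 0 | n + 1 => Sum.inl n : ℕ → ℕ ⊕ Fin 1) hp
  refine Dfn.congr (Set.Definable.exists_of_finite h) fun e => ?_
  exact ⟨fun ⟨x, hx⟩ => ⟨fun _ => x, hx⟩, fun ⟨x, hx⟩ => ⟨x 0, hx⟩⟩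

theorem Dfn.all {p : (ℕ → M) → M → Prop} (hp : Dfn fun e => p (fun n => e (n + 1)) (e 0)) :
    Dfn fun e => ∀ x, p e x :=
  (Dfn.ex (p := fun e x => ¬ p e x) hp.not).not.congr fun _ => not_exists_not.symm

/-- A definable unary predicate. -/
def Dfn₁ (p : M → Prop) : Prop := Dfn fun e : Fin 1 → M => p (e 0)

/-- A definable binary predicate. -/
def Dfn₂ (p : M → M → Prop) : Prop := Dfn fun e : Fin 2 → M => p (e 0) (e 1)

/-- A definable ternary predicate. -/
def Dfn₃ (p : M → M → M → Prop) : Prop := Dfn fun e : Fin 3 → M => p (e 0) (e 1) (e 2)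

/-- Quantifiers are handled on `ℕ`-indexed tuples, where they shift variables, whereas separation
needs one variable. The idle variables receive a parameter, hence the case split on emptiness. -/
theorem Dfn₁.of {p : M → Prop} (hp : Dfn fun e : ℕ → M => p (e 0)) : Dfn₁ p :=
  have : Nonempty M ∨ IsEmpty M := (isEmpty_or_nonempty M).symm
  this.elim (fun ⟨a⟩ => hp.subst fun n => if n = 0 then Sum.inl 0 else Sum.inr a)
    fun h => (Dfn.eq (DFun.var 0) (DFun.var 0)).congr fun e => (h.false (e 0)).elim

theorem Dfn₂.of {p : M → M → Prop} (hp : Dfn fun e : ℕ → M => p (e 0) (e 1)) : Dfn₂ p :=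
  have : Nonempty M ∨ IsEmpty M := (isEmpty_or_nonempty M).symm
  this.elim (fun ⟨a⟩ => hp.subst fun n => if n = 0 then Sum.inl 0 else
    if n = 1 then Sum.inl 1 else Sum.inr a)
    fun h => (Dfn.eq (DFun.var 0) (DFun.var 0)).congr fun e => (h.false (e 0)).elim

theorem Dfn₂.comp {p : M → M → Prop} (hp : Dfn₂ p) (hf : DFun f) (hg : DFun g) :
    Dfn fun e => p (f e) (g e) := by
  have hm : (Set.univ : Set M).DefinableMap setLang fun v => ![f v, g v] := by
    intro i
    fin_cases i
    · exact hf
    · exact hg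
  exact Set.Definable.preimage_map hm hp

theorem Dfn₃.comp {h : (α → M) → M} {p : M → M → M → Prop} (hp : Dfn₃ p) (hf : DFun f)
    (hg : DFun g) (hh : DFun h) : Dfn fun e => p (f e) (g e) (h e) := by
  have hm : (Set.univ : Set M).DefinableMap setLang fun v => ![f v, g v, h v] := by
    intro i
    fin_cases i
    · exact hf
    · exact hg
    · exact hh
  exact Set.Definable.preimage_map hm hp

/-! ### Pairs, separation and diagonalization in the ground model -/

variable [ZFCModel M]

theorem DFun.opair (hf : DFun f) (hg : DFun g) : DFun fun e => opair (f e) (g e) :=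
  definable_opair hf hg

theorem exists_sep {p : M → Prop} (hp : Dfn₁ p) (a : M) : ∃ b : M, ∀ x, x ∈ b ↔ x ∈ a ∧ p x :=
  ZFCModel.separation {x | p x} hp a

theorem upair_self_eq {a c d : M} (h : upair a a = upair c d) : c = a ∧ d = a := by
  have h' := fun x => mem_upair a a x
  simp only [h, mem_upair, or_self] at h'
  exact ⟨(h' c).1 (Or.inl rfl), (h' d).1 (Or.inr rfl)⟩

theorem opair_inj {a b c d : M} : opair a b = opair c d ↔ a = c ∧ b = d := by
  refine ⟨fun h => ?_, fun ⟨h, h'⟩ => h ▸ h' ▸ rfl⟩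
  have hac : a = c := by
    have : upair a a ∈ opair c d := h ▸ (mem_upair _ _ _).2 (Or.inl rfl)
    rcases (mem_upair _ _ _).1 this with h | h
    · exact (upair_self_eq h).1.symm
    · exact (upair_self_eq h).1.symm
  subst hac
  refine ⟨rfl, ?_⟩
  have h₁ : upair a b ∈ opair a d := h ▸ (mem_upair _ _ _).2 (Or.inr rfl)
  have h₂ : upair a d ∈ opair a b := h.symm ▸ (mem_upair _ _ _).2 (Or.inr rfl)
  rcases (mem_upair _ _ _).1 h₁ with h₁ | h₁
  · have hb := (upair_self_eq h₁.symm).2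
    subst hb
    rcases (mem_upair _ _ _).1 h₂ with h₂ | h₂ <;> exact (upair_self_eq h₂.symm).2.symm
  · rcases (mem_upair _ _ _).1 (h₁ ▸ (mem_upair a b b).2 (Or.inr rfl)) with hb | hb
    · subst hb
      exact (upair_self_eq h₁).2.symm
    · exact hb

theorem opair_mem_prod {a b x y : M} : opair x y ∈ prod a b ↔ x ∈ a ∧ y ∈ b := by
  rw [mem_prod]
  constructor
  · rintro ⟨x', y', hx, hy, h⟩
    obtain ⟨rfl, rfl⟩ := opair_inj.1 h
    exact ⟨hx, hy⟩
  · exact fun h => ⟨x, y, h.1, h.2, rfl⟩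

theorem zero_ne_one : (zero : M) ≠ one := fun h => by
  have h' : (zero : M) ∈ (one : M) := (mem_upair zero zero zero).2 (Or.inl rfl)
  rw [← h] at h'
  exact mem_emp _ h'

/-- A set that injects into `c` does not map onto the power set of `c`: given a definable relation
`T` between `a` and the power set of `c`, there are a choice function for `T` and a subset of `c`
that is not one of its values. -/
theorem exists_choice_avoiding {a b c : M} (hac : Equipotent c b) (hab : ∀ x, x ∈ a → x ∈ b)
    {T : M → M → Prop} (hT : Dfn₂ T) :
    ∃ (f : M → M) (d : M), d ∈ power c ∧ ∀ k, k ∈ a → d ≠ f k ∧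
      ∀ y, y ∈ power c → T k y → T k (f k) := by
  obtain ⟨j, hj₀, hj₁, hj₂⟩ := hac
  -- `P` is the set of the nonempty fibres of `T`, each tagged with its index `k`; the tags make
  -- them disjoint, as choice in `M` requires.
  obtain ⟨P, hP⟩ := exists_sep (p := fun p => ∃ k, k ∈ a ∧ (∃ y, y ∈ power c ∧ T k y) ∧
    ∀ z, z ∈ p ↔ ∃ y, y ∈ power c ∧ T k y ∧ z = opair k y) (by
      apply Dfn₁.of
      repeat' first
        | exact DFun.var _
        | exact DFun.const _
        | apply Dfn₂.comp hT
        | apply DFun.opair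
        | apply Dfn.mem
        | apply Dfn.eq
        | apply Dfn.ex
        | apply Dfn.and
        | apply Dfn.iff
        | apply Dfn.all) (power (prod a (power c)))
  have hPk : ∀ k, k ∈ a → (∃ y, y ∈ power c ∧ T k y) → ∃ p, p ∈ P ∧
      ∀ z, z ∈ p ↔ ∃ y, y ∈ power c ∧ T k y ∧ z = opair k y := by
    intro k hk hy
    obtain ⟨p, hp⟩ := exists_sep (p := fun z => ∃ y, y ∈ power c ∧ T k y ∧ z = opair k y) (by
      apply Dfn₁.of
      repeat' first
        | exact DFun.var _
        | exact DFun.const _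
        | apply Dfn₂.comp hT
        | apply DFun.opair
        | apply Dfn.mem
        | apply Dfn.eq
        | apply Dfn.ex
        | apply Dfn.and) (prod a (power c))
    have hp' : ∀ z, z ∈ p ↔ ∃ y, y ∈ power c ∧ T k y ∧ z = opair k y := by
      intro z
      rw [hp, and_iff_right_iff_imp]
      rintro ⟨y, hy, -, rfl⟩
      exact opair_mem_prod.2 ⟨hk, hy⟩
    refine ⟨p, (hP p).2 ⟨(mem_power _ _).2 fun z hz => ((hp z).1 hz).1, k, hk, hy, hp'⟩, hp'⟩
  obtain ⟨s, hs⟩ := ZFCModel.choice P (by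
    intro p hp
    obtain ⟨-, k, -, ⟨y, hy, hky⟩, h⟩ := (hP p).1 hp
    exact ⟨opair k y, (h _).2 ⟨y, hy, hky, rfl⟩⟩) (by
    intro p q z hp hq hzp hzq
    obtain ⟨-, k, -, -, h⟩ := (hP p).1 hp
    obtain ⟨-, l, -, -, h'⟩ := (hP q).1 hq
    obtain ⟨y, -, -, rfl⟩ := (h z).1 hzp
    obtain ⟨y', -, -, hyy⟩ := (h' _).1 hzq
    obtain ⟨rfl, -⟩ := opair_inj.1 hyy
    exact ZFCModel.extensionality _ _ fun z => (h z).trans (h' z).symm)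
  have hs' : ∀ k, k ∈ a → (∃ y, y ∈ power c ∧ T k y) →
      ∃ y, (y ∈ power c ∧ T k y ∧ opair k y ∈ s) ∧
        ∀ y', y' ∈ power c → T k y' → opair k y' ∈ s → y' = y := by
    intro k hk hy
    obtain ⟨p, hpP, hp⟩ := hPk k hk hy
    obtain ⟨z, ⟨hzp, hzs⟩, hz⟩ := hs p hpP
    obtain ⟨y, hy, hky, rfl⟩ := (hp z).1 hzp
    exact ⟨y, ⟨hy, hky, hzs⟩, fun y' hy' hky' hs => (opair_inj.1
      (hz _ ⟨(hp _).2 ⟨y', hy', hky', rfl⟩, hs⟩)).2⟩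
  -- Cantor's set: the `α` in `c` that code, through the bijection `j`, an index whose chosen value
  -- omits `α`.
  obtain ⟨d, hd⟩ := exists_sep (p := fun α => ∃ k y, k ∈ a ∧ y ∈ power c ∧ T k y ∧
    opair k y ∈ s ∧ opair α k ∈ j ∧ ¬ α ∈ y) (by
      apply Dfn₁.of
      repeat' first
        | exact DFun.var _
        | exact DFun.const _
        | apply Dfn₂.comp hT
        | apply DFun.opair
        | apply Dfn.mem
        | apply Dfn.ex
        | apply Dfn.and
        | apply Dfn.not) c
  have hf : ∀ k, ∃ x, k ∈ a → d ≠ x ∧ ∀ y, y ∈ power c → T k y → T k x := by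
    intro k
    by_cases hk : k ∈ a; swap
    · exact ⟨zero, fun h => absurd h hk⟩
    by_cases hy : ∃ y, y ∈ power c ∧ T k y; swap
    -- An index with an empty fibre may take any value other than `d`.
    · have : ∃ x, d ≠ x := by
        by_cases h : d = zero
        · exact ⟨one, h ▸ zero_ne_one⟩
        · exact ⟨zero, h⟩
      exact this.imp fun x hx _ => ⟨hx, fun y hyc hky => absurd ⟨y, hyc, hky⟩ hy⟩
    obtain ⟨x, ⟨hx, hkx, hxs⟩, hu⟩ := hs' k hk hy
    refine ⟨x, fun _ => ⟨?_, fun _ _ _ => hkx⟩⟩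
    rintro rfl
    obtain ⟨α, hα, -⟩ := hj₂ k (hab k hk)
    have key : α ∈ d ↔ ¬ α ∈ d := by
      constructor
      · intro h
        obtain ⟨-, k', y, hk', hyc, hky, hs'', hj', hαy⟩ := (hd α).1 h
        obtain ⟨l, hl, hl'⟩ := hj₁ α (((hd α).1 h).1)
        obtain rfl : k' = k := (hl' _ hj').trans (hl' _ hα).symm
        rwa [← hu y hyc hky hs'']
      · intro h
        obtain ⟨α', _, hα', -, hαk⟩ := hj₀ _ hα
        obtain ⟨rfl, rfl⟩ := opair_inj.1 hαk
        exact (hd α).2 ⟨hα', k, d, hk, hx, hkx, hxs, hα, h⟩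
    exact (iff_not_self key).elim
  choose f hf using hf
  exact ⟨f, d, (mem_power _ _).2 fun x hx => ((hd x).1 hx).1, hf⟩

end Definability

namespace RealizabilityAlgebra

variable {M : Type u} [Membership M M] [ZFCModel M] {A : RealizabilityAlgebra M} {I : Type u}

/-! ### The filter of a complete theory -/

section Complete

variable {S : Set (I → Set (Elts A.Stk))} {P Q : I → Set (Elts A.Stk)}

/-- The family of truth values that is `‖⊥‖` on `Z` and `‖⊤‖` elsewhere. -/
def flag (A : RealizabilityAlgebra M) (Z : Set I) : I → Set (Elts A.Stk) := fun i => {_π | i ∈ Z}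

theorem IsComplete.neg_mem (hS : IsComplete S) : (A.imp P fun _ => Set.univ) ∈ S ↔ P ∉ S :=
  ⟨fun h hP => hS.bot (hS.mp h hP), fun h => hS.imp_mem fun hP => absurd hP h⟩

/-- On `Z` a realizer of `P` realizes `Q`, so `¬ Q` yields `P → flag Z`. -/
theorem IsComplete.mem_of_flag (hS : IsComplete S) {Z : Set I} (hZ : A.flag Z ∉ S)
    (h : ∀ i ∈ Z, Q i ⊆ P i) (hP : P ∈ S) : Q ∈ S := by
  by_contra hQ
  refine hZ (hS.mp (hS.of_subset (fun i => ?_) (hS.neg_mem.2 hQ)) hP)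
  rintro _ ⟨ξ, π, rfl, hξ, hi⟩
  exact ⟨ξ, π, rfl, fun ρ hρ => hξ ρ (h i hi hρ), trivial⟩

/-- The filter of the sets that have value `1` in a complete theory. -/
def IsComplete.filter (hS : IsComplete S) : Filter I where
  sets := {Z | A.flag Z ∉ S}
  univ_sets := hS.bot
  sets_of_superset hZ h hZ' := hZ (hS.of_subset (fun _ _ hi => h hi) hZ')
  inter_sets {Z Z'} hZ hZ' h :=
    hZ' (hS.mem_of_flag (P := A.flag (Z ∩ Z')) hZ (fun _ hi _ hi' => And.intro hi hi') h)

theorem IsComplete.mem_congr (hS : IsComplete S) (h : ∀ᶠ i in hS.filter, P i = Q i) :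
    P ∈ S ↔ Q ∈ S :=
  ⟨hS.mem_of_flag h fun _ hi => hi.ge, hS.mem_of_flag h fun _ hi => hi.le⟩

/-- Interprets the conditional `↪` and the relativized quantifiers. When `p` does not have value
`1`, the flag of `p` is in the theory and already implies the conditional. -/
theorem IsComplete.cond_mem (hS : IsComplete S) {p : I → Prop} :
    (fun i => {π | p i ∧ π ∈ P i}) ∈ S ↔ ((∀ᶠ i in hS.filter, p i) → P ∈ S) := by
  refine ⟨fun h hp => hS.mem_of_flag hp (fun i hi π hπ => And.intro hi hπ) h, fun h => ?_⟩
  by_cases hp : ∀ᶠ i in hS.filter, p i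
  · exact hS.of_subset (fun i π hπ => hπ.2) (h hp)
  · exact hS.of_subset (fun i π hπ => hπ.1) (not_not.1 hp)

end Complete

/-! ### The Henkin model -/

section Henkin

variable {S : Set ((Name A → M) → Set (Elts A.Stk))}

theorem IsHenkin.all_mem (hS : IsHenkin S) (Q : (ℕ → M) → M → Set (Elts A.Stk))
    (v : ℕ → Name A) :
    (fun e => ⋃ a, Q (fun n => e (v n)) a) ∈ S ↔
      ∀ w, (fun e => Q (fun n => e (v n)) (e w)) ∈ S :=
  ⟨fun h _ => hS.of_subset (fun _ => Set.subset_iUnion_of_subset _ subset_rfl) h,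
    fun h => hS.mp (hS.henkin_mem Q v) (h _)⟩

/-- Otherwise `∀ a (a ≠ f(v))` would hold, but its truth value is `Π`. No definability of `f` is
needed, because Henkin witnesses exist for arbitrary families. -/
theorem IsHenkin.exists_name (hS : IsHenkin S) (f : (ℕ → M) → M) (v : ℕ → Name A) :
    ∃ w, ∀ᶠ e in hS.filter, e w = f fun n => e (v n) := by
  by_contra h
  rw [not_exists] at h
  refine hS.bot (hS.of_subset (fun e π _ => ?_)
    ((hS.all_mem (fun m a => {_π | a = f m}) v).2 fun w => not_not.1 (h w)))
  exact Set.mem_iUnion.2 ⟨_, rfl⟩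

/-- The relation `x ε y` of the Henkin model. -/
def Eps (S : Set ((Name A → M) → Set (Elts A.Stk))) (x y : Name A) : Prop :=
  (fun e => A.tvNeps (e x) (e y)) ∉ S

/-- The relation `(x, y) ε r` of the Henkin model. -/
def Rel (S : Set ((Name A → M) → Set (Elts A.Stk))) (r x y : Name A) : Prop :=
  (fun e => A.tvNeps (opair (e x) (e y)) (e r)) ∉ S

theorem mem_tvNeps_gimel {a X : M} {π : Elts A.Stk} : π ∈ A.tvNeps a (A.gimel X) ↔ a ∈ X :=
  opair_mem_prod.trans (and_iff_left π.2)

/-- The set `X` may vary with the valuation; this is what permits gluing two sets along an element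
of `ℷ2`. -/
theorem IsHenkin.eps_gimel (hS : IsHenkin S) {x w : Name A} {X : (Name A → M) → M}
    (hw : ∀ᶠ e in hS.filter, e w = A.gimel (X e)) :
    Eps S x w ↔ ∀ᶠ e in hS.filter, e x ∈ X e := by
  refine (hS.mem_congr ?_).not
  filter_upwards [hw] with e he
  ext π
  rw [he, mem_tvNeps_gimel]
  rfl

theorem IsHenkin.rel_congr (hS : IsHenkin S) {r x y x' y' : Name A}
    (hx : ∀ᶠ e in hS.filter, e x = e x') (hy : ∀ᶠ e in hS.filter, e y = e y') :
    Rel S r x y ↔ Rel S r x' y' := by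
  refine (hS.mem_congr ?_).not
  filter_upwards [hx, hy] with e hx hy
  rw [hx, hy]

/-- Leibniz equality is eventual equality. -/
theorem IsHenkin.eventually_eq_of_leibniz (hS : IsHenkin S) {x y : Name A}
    (h : ∀ z, Eps S y z → Eps S x z) : ∀ᶠ e in hS.filter, e x = e y := by
  -- The test individual is `ℷ{y}`.
  obtain ⟨z, hz⟩ := hS.exists_name (fun m => A.gimel (upair (m 0) (m 0))) fun _ => y
  have h' := (hS.eps_gimel hz).1 (h z ((hS.eps_gimel hz).2 (.of_forall fun e =>
    (mem_upair _ _ _).2 (Or.inl rfl))))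
  filter_upwards [h'] with e he
  simpa [mem_upair] using he

end Henkin

/-! ### Definability of truth values -/

section Definability

/-- The individual `y` is a stack in `X`. -/
def InTV (y : M) (X : Set (Elts A.Stk)) : Prop := ∃ h : y ∈ A.Stk, (⟨y, h⟩ : Elts A.Stk) ∈ X

/-- The graphs of push and process, being elements of `M`, turn implication of truth values into a
first-order condition over `M`. -/
theorem exists_inTV_impTV (A : RealizabilityAlgebra M) :
    ∃ g s : M, ∀ (X Y : Set (Elts A.Stk)) (y : M), InTV y (A.impTV X Y) ↔
      ∃ ξ π, (ξ ∈ A.Lam ∧ opair (opair ξ π) y ∈ g) ∧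
        (∀ ρ, InTV ρ X → ∃ p, opair (opair ξ ρ) p ∈ s ∧ p ∈ A.pole) ∧ InTV π Y := by
  obtain ⟨g, hg⟩ := A.push_internal
  obtain ⟨s, hs⟩ := A.star_internal
  refine ⟨g, s, fun X Y y => ⟨?_, ?_⟩⟩
  · rintro ⟨hy, ξ, π, hyp, hξ, hπ⟩
    refine ⟨ξ.1, π.1, ⟨ξ.2, (hg _).2 ⟨ξ, π, ?_⟩⟩, ?_, π.2, hπ⟩
    · rw [← hyp]
    · rintro ρ ⟨hρ, hρX⟩
      exact ⟨_, (hs _).2 ⟨ξ, ⟨ρ, hρ⟩, rfl⟩, hξ _ hρX⟩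
  · rintro ⟨ξ, π, ⟨hξ, hgy⟩, hX, hπ, hπY⟩
    obtain ⟨ξ', π', h⟩ := (hg _).1 hgy
    obtain ⟨h₀, h₃⟩ := opair_inj.1 h
    obtain ⟨h₁, h₂⟩ := opair_inj.1 h₀
    subst h₁ h₂ h₃
    refine ⟨(A.push ξ' π').2, ξ', π', rfl, fun ρ hρ => ?_, hπY⟩
    obtain ⟨p, hp, hpole⟩ := hX ρ.1 ⟨ρ.2, hρ⟩
    obtain ⟨ξ'', ρ'', h⟩ := (hs _).1 hp
    obtain ⟨h₀, rfl⟩ := opair_inj.1 h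
    obtain ⟨h₁, h₂⟩ := opair_inj.1 h₀
    rwa [Subtype.ext h₁, show ρ = ρ'' from Subtype.ext h₂]

/-- The family `Q` of truth values is definable. -/
def DTV (Q : (ℕ → M) → Set (Elts A.Stk)) : Prop :=
  Dfn fun m : ℕ → M => InTV (m 0) (Q fun n => m (n + 1))

theorem DTV.comp {Q : (ℕ → M) → Set (Elts A.Stk)} (hQ : DTV Q) (i : ℕ) (s : ℕ → ℕ) :
    Dfn fun m : ℕ → M => InTV (m i) (Q fun n => m (s n)) :=
  (Dfn.subst hQ (β := ℕ) fun n => Sum.inl (match n with | 0 => i | n + 1 => s n)).congr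
    fun _ => Iff.rfl

theorem DTV.imp {Q R : (ℕ → M) → Set (Elts A.Stk)} (hQ : DTV Q) (hR : DTV R) :
    DTV fun m => A.impTV (Q m) (R m) := by
  obtain ⟨g, s, h⟩ := exists_inTV_impTV A
  unfold DTV
  simp only [h]
  repeat' first
    | exact DTV.comp hQ _ _
    | exact DTV.comp hR _ _
    | exact DFun.var _
    | exact DFun.const _
    | apply DFun.opair
    | apply Dfn.mem
    | apply Dfn.ex
    | apply Dfn.and
    | apply Dfn.all
    | apply Dfn.imp

theorem inTV_iUnion {ι : Sort*} {y : M} {X : ι → Set (Elts A.Stk)} :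
    InTV y (⋃ i, X i) ↔ ∃ i, InTV y (X i) := by
  simp only [InTV, Set.mem_iUnion]
  exact exists_comm

theorem DTV.iUnion {Q : (ℕ → M) → Set (Elts A.Stk)} (hQ : DTV Q) :
    DTV fun m => ⋃ a, Q (cons a m) := by
  unfold DTV
  simp only [inTV_iUnion]
  refine Dfn.ex ((hQ.comp 1 fun n => match n with | 0 => 0 | n + 1 => n + 2).congr fun m => ?_)
  refine iff_of_eq (congrArg (fun m' => InTV (m 1) (Q m')) (funext fun n => ?_))
  cases n <;> rfl

theorem DTV.univ : DTV fun _ => (Set.univ : Set (Elts A.Stk)) :=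
  (Dfn.mem (DFun.var 0) (DFun.const A.Stk)).congr fun _ => ⟨fun h => h.1, fun h => ⟨h, trivial⟩⟩

theorem DTV.neps {f g : (ℕ → M) → M} (hf : DFun fun m : ℕ → M => f fun n => m (n + 1))
    (hg : DFun fun m : ℕ → M => g fun n => m (n + 1)) :
    DTV fun m => A.tvNeps (f m) (g m) :=
  ((Dfn.mem (DFun.var 0) (DFun.const A.Stk)).and
    (Dfn.mem (DFun.opair hf (DFun.var 0)) hg)).congr fun _ =>
    ⟨fun h => ⟨h.1, h.2⟩, fun h => ⟨h.1, h.2⟩⟩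

theorem DTV.section₂ {Q : (ℕ → M) → Set (Elts A.Stk)} (hQ : DTV Q) (m : ℕ → M) :
    Dfn₂ fun y x => InTV y (Q (cons x m)) := by
  refine (Dfn.subst hQ (β := Fin 2) fun n => match n with
    | 0 => .inl 0 | 1 => .inl 1 | n + 2 => .inr (m n)).congr fun e => ?_
  refine iff_of_eq (congrArg (fun m' => InTV (e 0) (Q m')) (funext fun n => ?_))
  cases n <;> rfl

theorem DTV.section₃ {Q : (ℕ → M) → Set (Elts A.Stk)} (hQ : DTV Q) (m : ℕ → M) :
    Dfn₃ fun z x y => InTV z (Q (cons x (cons y m))) := by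
  refine (Dfn.subst hQ (β := Fin 3) fun n => match n with
    | 0 => .inl 0 | 1 => .inl 1 | 2 => .inl 2 | n + 3 => .inr (m n)).congr fun e => ?_
  refine iff_of_eq (congrArg (fun m' => InTV (e 0) (Q m')) (funext fun n => ?_))
  rcases n with _ | _ | _ <;> rfl

/-- The individual `b` consists of the pairs `(z, π)` with `z` in `Y` and `π` in `‖¬ Q(z)‖`. Hence
`z ε̸ b` has the truth value of `¬ Q(z)` for `z` in `Y`, and an empty one elsewhere. -/
theorem exists_comprehension {Q : M → Set (Elts A.Stk)} (hQ : Dfn₂ fun y x => InTV y (Q x))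
    (Y : M) :
    ∃ b : M, ∀ z, A.tvNeps z b = {π | z ∈ Y ∧ π ∈ A.impTV (Q z) Set.univ} := by
  obtain ⟨g, s, h⟩ := exists_inTV_impTV A
  obtain ⟨b, hb⟩ := exists_sep (p := fun w => ∃ z y, w = opair z y ∧
    InTV y (A.impTV (Q z) Set.univ)) (by
      apply Dfn₁.of
      simp only [h]
      repeat' first
        | exact DTV.comp DTV.univ _ id
        | exact Dfn₂.comp hQ (DFun.var _) (DFun.var _)
        | exact DFun.var _
        | exact DFun.const _
        | apply DFun.opair
        | apply Dfn.mem
        | apply Dfn.eq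
        | apply Dfn.ex
        | apply Dfn.and
        | apply Dfn.all
        | apply Dfn.imp) (prod Y A.Stk)
  refine ⟨b, fun z => Set.ext fun π => (hb _).trans ?_⟩
  rw [opair_mem_prod]
  constructor
  · rintro ⟨⟨hz, -⟩, z', y, hzy, hy, hyQ⟩
    obtain ⟨rfl, rfl⟩ := opair_inj.1 hzy
    exact ⟨hz, hyQ⟩
  · exact fun h => ⟨⟨h.1, π.2⟩, z, π.1, rfl, π.2, h.2⟩

end Definability

/-! ### Internal predicates -/

section Internal

variable {S : Set ((Name A → M) → Set (Elts A.Stk))}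

/-- A predicate on tuples of names that is expressed by a definable family of truth values. -/
def Internal (S : Set ((Name A → M) → Set (Elts A.Stk))) (P : (ℕ → Name A) → Prop) : Prop :=
  ∃ Q : (ℕ → M) → Set (Elts A.Stk), DTV Q ∧ ∀ v, P v ↔ (fun e => Q fun n => e (v n)) ∈ S

namespace Internal

variable {P P' : (ℕ → Name A) → Prop}

theorem congr (hP : Internal S P) (h : ∀ v, P' v ↔ P v) : Internal S P' := by
  rwa [show P' = P from funext fun v => propext (h v)]

theorem imp (hS : IsHenkin S) (hP : Internal S P) (hP' : Internal S P') :
    Internal S fun v => P v → P' v := by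
  obtain ⟨Q, hQ, h⟩ := hP
  obtain ⟨Q', hQ', h'⟩ := hP'
  exact ⟨_, hQ.imp hQ', fun v => (imp_congr (h v) (h' v)).trans hS.imp_iff.symm⟩

theorem not (hS : IsHenkin S) (hP : Internal S P) : Internal S fun v => ¬ P v :=
  imp hS hP ⟨_, DTV.univ, fun _ => iff_of_false id hS.bot⟩

theorem and (hS : IsHenkin S) (hP : Internal S P) (hP' : Internal S P') :
    Internal S fun v => P v ∧ P' v :=
  (not hS (imp hS hP (not hS hP'))).congr fun _ => by tauto

theorem iff (hS : IsHenkin S) (hP : Internal S P) (hP' : Internal S P') :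
    Internal S fun v => P v ↔ P' v :=
  (and hS (imp hS hP hP') (imp hS hP' hP)).congr fun _ => iff_def

theorem all (hS : IsHenkin S) {P : (ℕ → Name A) → Name A → Prop}
    (hP : Internal S fun v => P (fun n => v (n + 1)) (v 0)) : Internal S fun v => ∀ x, P v x := by
  obtain ⟨Q, hQ, h⟩ := hP
  refine ⟨_, hQ.iUnion, fun v => ?_⟩
  rw [hS.all_mem (fun m a => Q (cons a m)) v]
  refine forall_congr' fun x => (h (cons x v)).trans (iff_of_eq ?_)
  refine congrArg (· ∈ S) (funext fun e => congrArg Q ?_)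
  exact comp_cons e x v

theorem ex (hS : IsHenkin S) {P : (ℕ → Name A) → Name A → Prop}
    (hP : Internal S fun v => P (fun n => v (n + 1)) (v 0)) : Internal S fun v => ∃ x, P v x :=
  (not hS (all hS (P := fun v x => ¬ P v x) (not hS hP))).congr fun _ => not_forall_not.symm

theorem eps (hS : IsHenkin S) (i j : ℕ) : Internal S fun v => Eps S (v i) (v j) :=
  (not hS ⟨_, DTV.neps (f := fun m => m i) (g := fun m => m j) (DFun.var _) (DFun.var _),
    fun _ => Iff.rfl⟩)

theorem rel (hS : IsHenkin S) (i j k : ℕ) : Internal S fun v => Rel S (v k) (v i) (v j) :=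
  (not hS ⟨_, DTV.neps (f := fun m => opair (m i) (m j)) (g := fun m => m k)
    (DFun.opair (DFun.var _) (DFun.var _)) (DFun.var _), fun _ => Iff.rfl⟩)

/-- Comprehension in the Henkin model. -/
theorem exists_eps_iff (hS : IsHenkin S) (hP : Internal S P) (v : ℕ → Name A) (X : M) :
    ∃ w, ∀ x, Eps S x w ↔ (∀ᶠ e in hS.filter, e x ∈ X) ∧ P (cons x v) := by
  obtain ⟨Q, hQ, h⟩ := hP
  choose b hb using fun m => exists_comprehension (hQ.section₂ m) X
  obtain ⟨w, hw⟩ := hS.exists_name b v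
  refine ⟨w, fun x => ?_⟩
  have h₁ : (fun e => A.tvNeps (e x) (e w)) ∈ S ↔ (fun e : Name A → M =>
      {π | e x ∈ X ∧ π ∈ A.impTV (Q (cons (e x) fun n => e (v n))) Set.univ}) ∈ S := by
    refine hS.mem_congr ?_
    filter_upwards [hw] with e he
    rw [he, hb]
  rw [Eps, h₁, hS.cond_mem (p := fun e : Name A → M => e x ∈ X), Classical.not_imp,
    h (cons x v)]
  simp only [comp_cons]
  refine and_congr_right fun _ => (not_congr hS.neg_mem).trans not_not

/-- Comprehension for relations in the Henkin model. -/
theorem exists_rel_iff (hS : IsHenkin S) (hP : Internal S P) (v : ℕ → Name A) (X : M) :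
    ∃ w, ∀ x y, Rel S w x y ↔
      (∀ᶠ e in hS.filter, e x ∈ X ∧ e y ∈ X) ∧ P (cons x (cons y v)) := by
  obtain ⟨Q, hQ, h⟩ := hP
  let R : (ℕ → M) → M → Set (Elts A.Stk) := fun m z =>
    {π | ∃ x y, z = opair x y ∧ π ∈ Q (cons x (cons y m))}
  have hR : ∀ m, Dfn₂ fun y z => InTV y (R m z) := by
    intro m
    apply Dfn₂.of
    refine Dfn.congr (p := fun e => ∃ x y, e 1 = opair x y ∧
      InTV (e 0) (Q (cons x (cons y m)))) ?_ ?_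
    · exact Dfn.ex (Dfn.ex (Dfn.and (Dfn.eq (DFun.var _) (DFun.opair (DFun.var _) (DFun.var _)))
        (Dfn₃.comp (hQ.section₃ m) (DFun.var _) (DFun.var _) (DFun.var _))))
    · exact fun e => ⟨fun ⟨h, x, y, hz, hy⟩ => ⟨x, y, hz, h, hy⟩,
        fun ⟨x, y, hz, h, hy⟩ => ⟨h, x, y, hz, hy⟩⟩
  have hR' : ∀ m x y, R m (opair x y) = Q (cons x (cons y m)) := by
    intro m x y
    ext π
    constructor
    · rintro ⟨x', y', hz, hπ⟩
      obtain ⟨rfl, rfl⟩ := opair_inj.1 hz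
      exact hπ
    · exact fun hπ => ⟨x, y, rfl, hπ⟩
  choose b hb using fun m => exists_comprehension (hR m) (prod X X)
  obtain ⟨w, hw⟩ := hS.exists_name b v
  refine ⟨w, fun x y => ?_⟩
  have h₁ : (fun e => A.tvNeps (opair (e x) (e y)) (e w)) ∈ S ↔ (fun e : Name A → M =>
      {π | (e x ∈ X ∧ e y ∈ X) ∧
        π ∈ A.impTV (Q (cons (e x) (cons (e y) fun n => e (v n)))) Set.univ}) ∈ S := by
    refine hS.mem_congr ?_
    filter_upwards [hw] with e he
    rw [he, hb, hR']
    simp only [opair_mem_prod]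
  rw [Rel, h₁, hS.cond_mem (p := fun e : Name A → M => e x ∈ X ∧ e y ∈ X), Classical.not_imp,
    h (cons x (cons y v))]
  simp only [comp_cons]
  refine and_congr_right fun _ => (not_congr hS.neg_mem).trans not_not

end Internal

end Internal

end RealizabilityAlgebra

/-! ### Comparison of well orderings -/

section Matching

variable {V : Type u} (lt : V → V → Prop) (D E : V → Prop) (rel : V → V → V → Prop)

/-- `b` is a minimal element of `E` that `G` does not relate to any predecessor of `a`. -/
def IsNext (G : V → V → Prop) (a b : V) : Prop :=
  (∀ x, D x → lt x a → ¬ G x b) ∧ ∀ y, E y → lt y b → ∃ x, D x ∧ lt x a ∧ G x y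

/-- The relation coded by `g` obeys the recursion of `IsNext` up to `a`. -/
def IsAttempt (g a : V) : Prop :=
  ∀ x, D x → ¬ lt a x → ∀ y, E y → (rel g x y ↔ IsNext lt D E (rel g) x y)

/-- The union of all attempts. -/
def Matches (a b : V) : Prop := D a ∧ E b ∧ ∃ g, IsAttempt lt D E rel g a ∧ rel g a b

/-- If `p` has an element in `D`, then it has a minimal one. -/
def HasMin (p : V → Prop) : Prop := (∃ x, D x ∧ p x) → ∃ x, D x ∧ p x ∧ ∀ y, D y → p y → ¬ lt y x

variable {lt D E rel}

theorem IsNext.congr {G G' : V → V → Prop} {a b : V}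
    (h : ∀ x, D x → lt x a → ∀ y, E y → (G x y ↔ G' x y)) (hb : E b) :
    IsNext lt D E G a b ↔ IsNext lt D E G' a b := by
  refine and_congr ?_ ?_
  · exact forall_congr' fun x => forall_congr' fun hx => forall_congr' fun hxa =>
      not_congr (h x hx hxa b hb)
  · exact forall_congr' fun y => forall_congr' fun hy => forall_congr' fun _ =>
      exists_congr fun x => and_congr_right fun hx => and_congr_right fun hxa => h x hx hxa y hy

/-- Transfinite recursion by attempts. Minimal elements and a code `g` are assumed only for the
predicates in use, since the Henkin model guarantees them only for internal predicates. The order is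
total only up to eventual equality, whence `hneg` and the use of `¬ lt a x` for `x ≤ a`. -/
theorem matches_iff_isNext (hirr : ∀ x, D x → ¬ lt x x)
    (htrans : ∀ x y z, D x → D y → D z → lt x y → lt y z → lt x z)
    (hneg : ∀ x y z, D x → D y → D z → lt x y → lt x z ∨ lt z y)
    (hmin : ∀ g g' a, HasMin lt D fun x => ¬ lt a x ∧ ∃ y, E y ∧ ¬ (rel g x y ↔ rel g' x y))
    (hmin' : HasMin lt D fun a => ¬ ∃ g, IsAttempt lt D E rel g a)
    (hcomp : ∃ g, ∀ x y, D x → E y →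
      (rel g x y ↔ IsNext lt D E (Matches lt D E rel) x y))
    {a b : V} (ha : D a) (hb : E b) :
    Matches lt D E rel a b ↔ IsNext lt D E (Matches lt D E rel) a b := by
  have huniq : ∀ g g' a x y, D a → IsAttempt lt D E rel g a → IsAttempt lt D E rel g' a → D x →
      ¬ lt a x → E y → (rel g x y ↔ rel g' x y) := by
    intro g g' a x y ha hg hg' hx hax hy
    by_contra h
    obtain ⟨z, hz, ⟨haz, w, hw, hzw⟩, hleast⟩ := hmin g g' a ⟨x, hx, hax, y, hy, h⟩
    refine hzw ?_
    rw [hg z hz haz w hw, hg' z hz haz w hw]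
    refine IsNext.congr (fun x' hx' hxz y' hy' => ?_) hw
    by_contra h'
    exact hleast x' hx' ⟨fun h => haz (htrans _ _ _ ha hx' hz h hxz), y', hy', h'⟩ hxz
  have hmono : ∀ g a x, D a → D x → IsAttempt lt D E rel g a → ¬ lt a x →
      IsAttempt lt D E rel g x := by
    intro g a x ha hx hg hax z hz hxz
    exact hg z hz fun h => (hneg _ _ _ ha hz hx h).elim hax hxz
  have hrel : ∀ g a x y, D a → D x → E y → IsAttempt lt D E rel g a → ¬ lt a x →
      (Matches lt D E rel x y ↔ rel g x y) := by
    intro g a x y ha hx hy hg hax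
    have hgx := hmono g a x ha hx hg hax
    exact ⟨fun ⟨_, _, g', hg', h⟩ => (huniq g g' x x y hx hgx hg' hx (hirr x hx) hy).2 h,
      fun h => ⟨hx, hy, g, hgx, h⟩⟩
  have hnext : ∀ a b, D a → E b → (∃ g, IsAttempt lt D E rel g a) →
      (Matches lt D E rel a b ↔ IsNext lt D E (Matches lt D E rel) a b) := by
    rintro a b ha hb ⟨g, hg⟩
    rw [hrel g a a b ha ha hb hg (hirr a ha), hg a ha (hirr a ha) b hb]
    refine IsNext.congr (fun x hx hxa y hy => (hrel g a x y ha hx hy hg fun h => ?_).symm) hb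
    exact hirr a ha (htrans _ _ _ ha hx ha h hxa)
  refine hnext a b ha hb ?_
  by_contra hna
  -- Below a minimal `c` without attempt, `Matches` obeys the recursion; so the relation that codes
  -- one further step of it is an attempt at `c`.
  obtain ⟨c, hc, hnc, hleast⟩ := hmin' ⟨a, ha, hna⟩
  obtain ⟨g, hg⟩ := hcomp
  refine hnc ⟨g, fun x hx hcx y hy => ?_⟩
  rw [hg x y hx hy]
  refine IsNext.congr (fun z hz hzx w hw => ?_) hy
  have hzc : lt z c := (hneg _ _ _ hz hx hc hzx).resolve_right hcx
  rw [hg z w hz hw]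
  exact hnext z w hz hw (not_not.1 fun h => hleast z hz h hzc)

/-- If some `b` is never matched, then for every `a` the elements unmatched below `a` are nonempty,
and a minimal one matches `a`. -/
theorem matches_left_or_right
    (hnext : ∀ a b, D a → E b →
      (Matches lt D E rel a b ↔ IsNext lt D E (Matches lt D E rel) a b))
    (hmin : ∀ a, HasMin lt E fun b => ∀ x, D x → lt x a → ¬ Matches lt D E rel x b) :
    (∀ b, E b → ∃ a, Matches lt D E rel a b) ∨ ∀ a, D a → ∃ b, Matches lt D E rel a b := by
  refine or_iff_not_imp_left.2 fun h a ha => ?_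
  push Not at h
  obtain ⟨b, hb, hab⟩ := h
  obtain ⟨c, hc, hca, hleast⟩ := hmin a ⟨b, hb, fun x _ _ => hab x⟩
  refine ⟨c, (hnext a c ha hc).2 ⟨hca, fun y hy hyc => ?_⟩⟩
  by_contra! h
  exact hleast y hy h hyc

theorem Matches.not_lt_right
    (hnext : ∀ a b, D a → E b →
      (Matches lt D E rel a b ↔ IsNext lt D E (Matches lt D E rel) a b))
    {a b b' : V} (h : Matches lt D E rel a b) (h' : Matches lt D E rel a b') : ¬ lt b b' := by
  intro hlt
  obtain ⟨x, hx, hxa, hxb⟩ := ((hnext a b' h'.1 h'.2.1).1 h').2 b h.2.1 hlt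
  exact ((hnext a b h.1 h.2.1).1 h).1 x hx hxa hxb

theorem Matches.not_lt_left
    (hnext : ∀ a b, D a → E b →
      (Matches lt D E rel a b ↔ IsNext lt D E (Matches lt D E rel) a b))
    {a a' b : V} (h : Matches lt D E rel a b) (h' : Matches lt D E rel a' b) : ¬ lt a a' :=
  fun hlt => ((hnext a' b h'.1 h'.2.1).1 h').1 a h.1 hlt h

end Matching

/-! ### Diagonal argument and comparison of the two glued sets -/

namespace RealizabilityAlgebra

variable {M : Type u} [Membership M M] [ZFCModel M] {A : RealizabilityAlgebra M}
  {S : Set ((Name A → M) → Set (Elts A.Stk))}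

/-- A functional relation whose arguments are `0` outside of `Z` and that has all values in a
power set outside of `Z` forces `Z` to have value `1`. -/
theorem IsHenkin.eventually_of_surjective (hS : IsHenkin S) {P : (ℕ → Name A) → Prop}
    (hP : Internal S P) (v : ℕ → Name A) {b c : M} (hbc : Equipotent c b)
    (hb : ∀ x, x ∈ A.Stk → x ∈ b) {Z : (ℕ → M) → Prop}
    (hdom : ∀ x y, P (cons x (cons y v)) →
      ∀ᶠ e in hS.filter, ¬ Z (fun n => e (v n)) → e x = zero)
    (hran : ∀ x y, P (cons x (cons y v)) → ∀ᶠ e in hS.filter, e y ∈ power c)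
    (hfun : ∀ x y y', P (cons x (cons y v)) → P (cons x (cons y' v)) →
      ∀ᶠ e in hS.filter, e y = e y')
    (hsurj : ∀ y, (∀ᶠ e in hS.filter, (Z (fun n => e (v n)) → e y = zero) ∧
      (¬ Z (fun n => e (v n)) → e y ∈ power c)) → ∃ x, P (cons x (cons y v))) :
    ∀ᶠ e in hS.filter, Z fun n => e (v n) := by
  classical
  obtain ⟨Q, hQ, hPQ⟩ := hP
  let G : (ℕ → M) → M → M → Set (Elts A.Stk) := fun m x y =>
    A.impTV (Q (cons x (cons y m))) Set.univ
  have hPG : ∀ x y, P (cons x (cons y v)) ↔ (fun e => G (fun n => e (v n)) (e x) (e y)) ∉ S := by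
    intro x y
    rw [hPQ]
    simp only [comp_cons]
    exact not_not.symm.trans (not_congr hS.neg_mem.symm)
  have hf : ∀ m, ∃ (f : M → M → M) (d : M), d ∈ power c ∧ (∀ k, k ∈ A.Stk → d ≠ f zero k) ∧
      ∀ x y k, k ∈ A.Stk → y ∈ power c → InTV k (G m x y) → InTV k (G m x (f x k)) := by
    intro m
    have hG : Dfn₂ fun k y => InTV k (G m zero y) :=
      Dfn₂.of <| ((hQ.imp DTV.univ).section₃ m).comp (DFun.var 0) (DFun.const zero) (DFun.var 1)
    obtain ⟨f, d, hd, h⟩ := exists_choice_avoiding hbc hb hG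
    have h' : ∀ x k, ∃ z, ∀ y, InTV k (G m x y) → InTV k (G m x z) := by
      intro x k
      by_cases hy : ∃ y, InTV k (G m x y)
      · exact hy.imp fun z hz _ _ => hz
      · exact ⟨zero, fun y h => absurd ⟨y, h⟩ hy⟩
    choose f' hf' using h'
    -- Only the argument `0` is diagonalized against, since it is the only one off `Z`; elsewhere
    -- any choice function will do.
    refine ⟨fun x k => if x = zero then f k else f' x k, d, hd, fun k hk => ?_, ?_⟩
    · simpa using (h k hk).1
    · intro x y k hk hy hxy
      by_cases hx : x = zero
      · subst hx
        simpa using (h k hk).2 y hy hxy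
      · simpa [hx] using hf' x k y hxy
  choose f d hd hdf hGf using hf
  -- The value to be hit is the diagonal set off `Z`, and `0` on `Z`.
  obtain ⟨y, hy⟩ := hS.exists_name (fun m => if Z m then zero else d m) v
  obtain ⟨x, hxy⟩ := hsurj y (by
    filter_upwards [hy] with e he
    rw [he]
    refine ⟨fun h => by simp [h], fun h => by simp [h, hd]⟩)
  -- Non-extensional choice: each stack `π` of `‖¬ P(x, y)‖` also lies in `‖¬ P(x, f(x, π))‖`, so if
  -- `P(x, f(x, k))` failed for all `k` in `ℷΠ`, then `P(x, y)` would fail.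
  have hk : ∃ k, (fun e : Name A → M => {π | e k ∈ A.Stk ∧
      π ∈ G (fun n => e (v n)) (e x) (f (fun n => e (v n)) (e x) (e k))}) ∉ S := by
    by_contra hk
    rw [not_exists] at hk
    refine (hPG x y).1 hxy (hS.mem_of_flag (hran x y hxy) ?_ ((hS.all_mem (fun m k => {π |
      k ∈ A.Stk ∧ π ∈ G (fun n => m (n + 1)) (m 0) (f (fun n => m (n + 1)) (m 0) k)})
      (cons x v)).2 fun k => not_not.1 (hk k)))
    intro e he π hπ
    exact Set.mem_iUnion.2 ⟨π.1, π.2, (hGf _ _ _ _ π.2 he ⟨π.2, hπ⟩).2⟩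
  obtain ⟨k, hk⟩ := hk
  rw [hS.cond_mem (p := fun e : Name A → M => e k ∈ A.Stk), Classical.not_imp] at hk
  obtain ⟨y', hy'⟩ := hS.exists_name (fun m => f (fun n => m (n + 2)) (m 0) (m 1))
    (cons x (cons k v))
  have hxy' : P (cons x (cons y' v)) := by
    refine (hPG x y').2 fun h => hk.2 ((hS.mem_congr ?_).1 h)
    filter_upwards [hy'] with e he
    rw [he]
    rfl
  -- Off `Z`, functionality would give `d = f(0, k)` for a stack `k`.
  filter_upwards [hy, hy', hfun x y y' hxy hxy', hdom x y hxy, hk.1] with e h₁ h₂ h₃ h₄ h₅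
  by_contra hZ
  rw [h₁, h₂, if_neg hZ] at h₃
  refine hdf _ _ h₅ (h₃.trans ?_)
  rw [← h₄ hZ]
  rfl

/-- `r` is a strict well ordering of `ℷX` in the Henkin model. -/
structure IsWellOrderOf (hS : IsHenkin S) (r : Name A) (X : M) : Prop where
  irrefl : ∀ x, (∀ᶠ e in hS.filter, e x ∈ X) → ¬ Rel S r x x
  trans : ∀ x y z, (∀ᶠ e in hS.filter, e x ∈ X) → (∀ᶠ e in hS.filter, e y ∈ X) →
    (∀ᶠ e in hS.filter, e z ∈ X) → Rel S r x y → Rel S r y z → Rel S r x z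
  total : ∀ x y, (∀ᶠ e in hS.filter, e x ∈ X) → (∀ᶠ e in hS.filter, e y ∈ X) →
    Rel S r x y ∨ Rel S r y x ∨ ∀ᶠ e in hS.filter, e x = e y
  min : ∀ w, (∃ x, (∀ᶠ e in hS.filter, e x ∈ X) ∧ Eps S x w) →
    ∃ x, (∀ᶠ e in hS.filter, e x ∈ X) ∧ Eps S x w ∧
      ∀ y, (∀ᶠ e in hS.filter, e y ∈ X) → Eps S y w → ¬ Rel S r y x

/-- Comprehension collects an internal predicate into an individual, to which the minimality clause
applies. -/
theorem IsWellOrderOf.hasMin {hS : IsHenkin S} {r : Name A} {X : M} (hr : IsWellOrderOf hS r X)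
    {D : Name A → Prop} (hD : ∀ x, D x → ∀ᶠ e in hS.filter, e x ∈ X)
    {P : (ℕ → Name A) → Prop} (hP : Internal S P) (v : ℕ → Name A) {p : Name A → Prop}
    (hp : ∀ x, P (cons x v) ↔ D x ∧ p x) : HasMin (Rel S r) D p := by
  rintro ⟨x, hx, hpx⟩
  obtain ⟨w, hw⟩ := hP.exists_eps_iff hS v X
  obtain ⟨y, -, hy, hmin⟩ := hr.min w ⟨x, hD x hx, (hw x).2 ⟨hD x hx, (hp x).2 ⟨hx, hpx⟩⟩⟩
  have hy' := (hp y).1 ((hw y).1 hy).2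
  exact ⟨y, hy'.1, hy'.2, fun z hz hpz =>
    hmin z (hD z hz) ((hw z).2 ⟨hD z hz, (hp z).2 ⟨hz, hpz⟩⟩)⟩

theorem Internal.isAttempt (hS : IsHenkin S) (r a b g x : ℕ) :
    Internal S fun v => IsAttempt (Rel S (v r)) (Eps S · (v a)) (Eps S · (v b)) (Rel S) (v g)
      (v x) := by
  simp only [IsAttempt, IsNext]
  repeat' first
    | exact Internal.eps hS _ _
    | exact Internal.rel hS _ _ _
    | apply Internal.and hS
    | apply Internal.iff hS
    | apply Internal.ex hS
    | apply Internal.all hS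
    | apply Internal.not hS
    | apply Internal.imp hS

theorem Internal.matches (hS : IsHenkin S) (r a b x y : ℕ) :
    Internal S fun v => Matches (Rel S (v r)) (Eps S · (v a)) (Eps S · (v b)) (Rel S) (v x)
      (v y) :=
  (eps hS _ _).and hS ((eps hS _ _).and hS (ex hS ((isAttempt hS _ _ _ _ _).and hS
    (rel hS _ _ _))))

theorem Internal.isNext_matches (hS : IsHenkin S) (r a b x y : ℕ) :
    Internal S fun v => IsNext (Rel S (v r)) (Eps S · (v a)) (Eps S · (v b))
      (Matches (Rel S (v r)) (Eps S · (v a)) (Eps S · (v b)) (Rel S)) (v x) (v y) := by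
  unfold IsNext
  repeat' first
    | exact Internal.eps hS _ _
    | exact Internal.rel hS _ _ _
    | exact Internal.matches hS _ _ _ _ _
    | apply Internal.and hS
    | apply Internal.ex hS
    | apply Internal.all hS
    | apply Internal.not hS
    | apply Internal.imp hS

theorem IsHenkin.not_isWellOrderOf (hS : IsHenkin S) {c : M} (hc : Equipotent c A.base)
    {i : Name A} (hi : ∀ᶠ e in hS.filter, e i ∈ (two : M)) (hi₀ : ¬ ∀ᶠ e in hS.filter, e i = zero)
    (hi₁ : ¬ ∀ᶠ e in hS.filter, e i = one) (r : Name A) : ¬ IsWellOrderOf hS r (power c) := by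
  classical
  intro hr
  -- The sets glued along `i`: wherever one is all of `ℷκ₊`, the other is `ℷ{0}`.
  obtain ⟨α, hα⟩ := hS.exists_name
    (fun m => A.gimel (if m 0 = one then power c else upair zero zero)) fun _ => i
  obtain ⟨β, hβ⟩ := hS.exists_name
    (fun m => A.gimel (if m 0 = one then upair zero zero else power c)) fun _ => i
  have hα' := fun x => hS.eps_gimel (x := x) hα
  have hβ' := fun x => hS.eps_gimel (x := x) hβ
  have hzero : zero ∈ power c := (mem_power _ _).2 fun y hy => absurd hy (mem_emp y)
  have hsub : ∀ x : M, x ∈ (upair zero zero : M) → x ∈ power c := fun x hx => by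
    obtain rfl : x = zero := by simpa [mem_upair] using hx
    exact hzero
  have hαX : ∀ x, Eps S x α → ∀ᶠ e in hS.filter, e x ∈ power c := by
    intro x hx
    filter_upwards [(hα' x).1 hx] with e he
    split_ifs at he
    exacts [he, hsub _ he]
  have hβX : ∀ x, Eps S x β → ∀ᶠ e in hS.filter, e x ∈ power c := by
    intro x hx
    filter_upwards [(hβ' x).1 hx] with e he
    split_ifs at he
    exacts [hsub _ he, he]
  let v : ℕ → Name A := cons r (cons α (cons β fun _ => i))
  let F := Matches (Rel S r) (Eps S · α) (Eps S · β) (Rel S)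
  have hnext : ∀ a b, Eps S a α → Eps S b β →
      (F a b ↔ IsNext (Rel S r) (Eps S · α) (Eps S · β) F a b) := by
    intro a b ha hb
    refine matches_iff_isNext (fun x hx => hr.irrefl x (hαX x hx))
      (fun x y z hx hy hz => hr.trans x y z (hαX x hx) (hαX y hy) (hαX z hz)) ?_ ?_ ?_ ?_ ha hb
    · intro x y z hx hy hz hxy
      rcases hr.total x z (hαX x hx) (hαX z hz) with h | h | h
      · exact Or.inl h
      · exact Or.inr (hr.trans z x y (hαX z hz) (hαX x hx) (hαX y hy) h hxy)
      · exact Or.inr ((hS.rel_congr h (.of_forall fun _ => rfl)).1 hxy)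
    · intro g g' a
      refine hr.hasMin hαX (P := fun v => Eps S (v 0) (v 2) ∧ ¬ Rel S (v 1) (v 4) (v 0) ∧
        ∃ y, Eps S y (v 3) ∧ ¬ (Rel S (v 5) (v 0) y ↔ Rel S (v 6) (v 0) y)) ?_
        (cons r (cons α (cons β (cons a (cons g fun _ => g'))))) fun x => Iff.rfl
      exact (Internal.eps hS _ _).and hS (((Internal.rel hS _ _ _).not hS).and hS
        (Internal.ex hS ((Internal.eps hS _ _).and hS
          (((Internal.rel hS _ _ _).iff hS (Internal.rel hS _ _ _)).not hS))))
    · refine hr.hasMin hαX (P := fun v => Eps S (v 0) (v 2) ∧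
        ¬ ∃ g, IsAttempt (Rel S (v 1)) (Eps S · (v 2)) (Eps S · (v 3)) (Rel S) g (v 0)) ?_
        v fun x => Iff.rfl
      exact (Internal.eps hS _ _).and hS
        ((Internal.ex hS (Internal.isAttempt hS _ _ _ _ _)).not hS)
    · obtain ⟨g, hg⟩ := Internal.exists_rel_iff hS (P := fun v =>
        IsNext (Rel S (v 2)) (Eps S · (v 3)) (Eps S · (v 4))
          (Matches (Rel S (v 2)) (Eps S · (v 3)) (Eps S · (v 4)) (Rel S)) (v 0) (v 1))
        (Internal.isNext_matches hS _ _ _ _ _) v (power c)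
      exact ⟨g, fun x y hx hy => (hg x y).trans (and_iff_right ((hαX x hx).and (hβX y hy)))⟩
  have hleft : ∀ a a' b, F a b → F a' b → ∀ᶠ e in hS.filter, e a = e a' := fun a a' b h h' =>
    ((hr.total a a' (hαX a h.1) (hαX a' h'.1)).resolve_left
      (h.not_lt_left hnext h')).resolve_left (h'.not_lt_left hnext h)
  have hright : ∀ a b b', F a b → F a b' → ∀ᶠ e in hS.filter, e b = e b' := fun a b b' h h' =>
    ((hr.total b b' (hβX b h.2.1) (hβX b' h'.2.1)).resolve_left
      (h.not_lt_right hnext h')).resolve_left (h'.not_lt_right hnext h)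
  have hbase : ∀ x, x ∈ A.Stk → x ∈ A.base := fun x hx =>
    (mem_cup _ _ _).2 (Or.inl ((mem_cup _ _ _).2 (Or.inr hx)))
  have hsurj := matches_left_or_right hnext fun a => hr.hasMin hβX
    (P := fun v => Eps S (v 0) (v 3) ∧ ∀ x, Eps S x (v 2) → Rel S (v 1) x (v 4) →
      ¬ Matches (Rel S (v 1)) (Eps S · (v 2)) (Eps S · (v 3)) (Rel S) x (v 0))
    ((Internal.eps hS _ _).and hS (Internal.all hS ((Internal.eps hS _ _).imp hS
      ((Internal.rel hS _ _ _).imp hS ((Internal.matches hS _ _ _ _ _).not hS)))))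
    (cons r (cons α (cons β fun _ => a))) fun x => Iff.rfl
  rcases hsurj with hsurj | hsurj
  -- The matching is onto `β`: off `i = 1` its arguments are `0` and its values exhaust the power
  -- set, so `i = 1`. In `v` the entry of index `3` is `i`.
  · refine hi₁ (hS.eventually_of_surjective (P := fun v => Matches (Rel S (v 2)) (Eps S · (v 3))
      (Eps S · (v 4)) (Rel S) (v 0) (v 1)) (Internal.matches hS _ _ _ _ _) v hc hbase (Z := fun m => m 3 = one)
      ?_ (fun x y h => hβX y h.2.1) hright fun y hy => hsurj y ((hβ' y).2 ?_))
    · intro x y h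
      filter_upwards [(hα' x).1 h.1] with e he hne
      have hne' : ¬ e i = one := hne
      rw [if_neg hne'] at he
      simpa [mem_upair] using he
    · filter_upwards [hy] with e he
      split_ifs with h
      · exact (mem_upair _ _ _).2 (Or.inl (he.1 h))
      · exact he.2 h
  -- The inverse matching is onto `α`; the same argument off `i ≠ 1` gives `i ≠ 1`, that is `i = 0`.
  · have h := hS.eventually_of_surjective (P := fun v => Matches (Rel S (v 2)) (Eps S · (v 3))
      (Eps S · (v 4)) (Rel S) (v 1) (v 0)) (Internal.matches hS _ _ _ _ _) v hc hbase (Z := fun m => ¬ m 3 = one)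
      ?_ (fun x y h => hαX y h.1) (fun x y y' => hleft y y' x) fun y hy => hsurj y ((hα' y).2 ?_)
    · refine hi₀ ?_
      filter_upwards [hi, h] with e he hne
      exact ((mem_upair _ _ _).1 he).resolve_right hne
    · intro x y h
      filter_upwards [(hβ' x).1 h.2.1] with e he hne
      have hne' : e i = one := not_not.1 hne
      rw [if_pos hne'] at he
      simpa [mem_upair] using he
    · filter_upwards [hy] with e he
      split_ifs with h
      · exact he.2 (not_not.2 h)
      · exact (mem_upair _ _ _).2 (Or.inl (he.1 h))

/-! ### Satisfaction of formulas in the Henkin model -/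

/-- The formula `F` holds in the Henkin model under the assignment `v`. -/
def Sat (S : Set ((Name A → M) → Set (Elts A.Stk))) (F : Fml M) (v : ℕ → Name A) : Prop :=
  (fun e => A.tv F fun n => e (v n)) ∈ S

theorem IsHenkin.sat_imp (hS : IsHenkin S) {F G : Fml M} {v : ℕ → Name A} :
    Sat S (.imp F G) v ↔ (Sat S F v → Sat S G v) := hS.imp_iff

theorem IsHenkin.sat_bot (hS : IsHenkin S) {v : ℕ → Name A} : ¬ Sat S .bot v := hS.bot

theorem comp_update (e : Name A → M) (v : ℕ → Name A) (x : ℕ) (w : Name A) :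
    (fun n => e (Function.update v x w n)) = Function.update (fun n => e (v n)) x (e w) :=
  Function.comp_update e v x w

theorem IsHenkin.sat_all (hS : IsHenkin S) {F : Fml M} {x : ℕ} {v : ℕ → Name A} :
    Sat S (.all x F) v ↔ ∀ w, Sat S F (Function.update v x w) := by
  simp only [Sat, comp_update]
  rw [← hS.all_mem (fun m a => A.tv F (Function.update m x a)) v]
  refine iff_of_eq (congrArg (· ∈ S) (funext fun e => Set.ext fun π => ?_))
  exact Set.mem_iUnion.symm

theorem IsHenkin.sat_allGimel (hS : IsHenkin S) {F : Fml M} {x : ℕ} {X : M} {v : ℕ → Name A} :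
    Sat S (.allGimel x X F) v ↔
      ∀ w, (∀ᶠ e in hS.filter, e w ∈ X) → Sat S F (Function.update v x w) := by
  simp only [Sat, comp_update, ← hS.cond_mem]
  rw [← hS.all_mem (fun m a => {π | a ∈ X ∧ π ∈ A.tv F (Function.update m x a)}) v]
  refine iff_of_eq (congrArg (· ∈ S) (funext fun e => Set.ext fun π => ?_))
  exact Iff.trans Iff.rfl (Set.mem_iUnion (s := fun a =>
    {π | a ∈ X ∧ π ∈ A.tv F (Function.update (fun n => e (v n)) x a)})).symm

theorem IsHenkin.sat_ne (hS : IsHenkin S) {t u : LTerm M} {v : ℕ → Name A} :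
    Sat S (.ne t u) v ↔
      ¬ ∀ᶠ e in hS.filter, t.val (fun n => e (v n)) = u.val fun n => e (v n) :=
  (hS.cond_mem (P := fun _ => Set.univ)).trans (imp_congr_right fun _ => iff_of_false hS.bot id)

theorem IsHenkin.sat_eps (hS : IsHenkin S) {t u : LTerm M} {v : ℕ → Name A} :
    Sat S (.eps t u) v ↔
      (fun e => A.tvNeps (t.val fun n => e (v n)) (u.val fun n => e (v n))) ∉ S :=
  hS.neg_mem

theorem IsHenkin.sat_eps_var (hS : IsHenkin S) {i j : ℕ} {v : ℕ → Name A} :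
    Sat S (.eps (.var i) (.var j)) v ↔ Eps S (v i) (v j) := hS.sat_eps

theorem sat_neps_var {i j : ℕ} {v : ℕ → Name A} :
    Sat S (.neps (.var i) (.var j)) v ↔ ¬ Eps S (v i) (v j) := not_not.symm

theorem IsHenkin.sat_rel_var (hS : IsHenkin S) {i j k : ℕ} {v : ℕ → Name A} :
    Sat S (.eps (.pair (.var i) (.var j)) (.var k)) v ↔ Rel S (v k) (v i) (v j) := hS.sat_eps

theorem IsHenkin.sat_eps_gimel (hS : IsHenkin S) {i : ℕ} {X : M} {v : ℕ → Name A} :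
    Sat S (.eps (.var i) (.const (A.gimel X))) v ↔ ∀ᶠ e in hS.filter, e (v i) ∈ X :=
  hS.sat_eps.trans (hS.mem_congr (.of_forall fun _ => Set.ext fun _ => mem_tvNeps_gimel)).not

/-- The hypothesis on `E` covers both the constant `ℷX` and the variable `x₇`, which no quantifier
of the formula binds. -/
theorem IsHenkin.isWellOrderOf_of_sat (hS : IsHenkin S) {X : M} {v : ℕ → Name A} {E : LTerm M}
    (hE : ∀ v' : ℕ → Name A, v' 7 = v 7 → ∀ i, Sat S (.eps (.var i) E) v' ↔
      ∀ᶠ e in hS.filter, e (v' i) ∈ X)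
    (h : Sat S (.isWellOrder (.var 5) E) v) : IsWellOrderOf hS (v 5) X := by
  simp [Fml.isWellOrder, Fml.conj, Fml.imps, Fml.disj, Fml.ex, Fml.rel, Fml.neg, Fml.eq,
    hS.sat_imp, hS.sat_bot, hS.sat_all, hS.sat_eps_var, sat_neps_var, hS.sat_rel_var, hE] at h
  obtain ⟨h₁, h₂, h₃, h₄⟩ := h
  refine ⟨h₁, h₂, fun x y hx hy => ?_, fun w ⟨x, hx, hxw⟩ => ?_⟩
  · by_contra hxy
    rw [not_or, not_or] at hxy
    refine hxy.2.2 (hS.eventually_eq_of_leibniz fun z => ?_)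
    exact not_imp_not.1 (h₃ x y hx hy hxy.1 hxy.2.1 z)
  · exact h₄ w x hx hxw

theorem IsHenkin.sat_notWellOrderable (hS : IsHenkin S) {c : M} (hc : Equipotent c A.base)
    {i : Name A} (hi : ∀ᶠ e in hS.filter, e i ∈ (two : M))
    (hi₀ : ¬ ∀ᶠ e in hS.filter, e i = zero) (hi₁ : ¬ ∀ᶠ e in hS.filter, e i = one)
    {v : ℕ → Name A} {E : LTerm M} (hE : ∀ v' : ℕ → Name A, v' 7 = v 7 → ∀ i,
      Sat S (.eps (.var i) E) v' ↔ ∀ᶠ e in hS.filter, e (v' i) ∈ power c) :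
    Sat S (.notWellOrderable E) v := by
  simp only [Fml.notWellOrderable, Fml.ex, Fml.neg, Fml.imps, List.foldr, hS.sat_imp, hS.sat_all]
  refine fun h => h fun r hr => (hS.not_isWellOrderOf hc hi hi₀ hi₁ _
    (hS.isWellOrderOf_of_sat (fun v' hv' => hE v' ?_) hr)).elim
  rw [hv', Function.update_of_ne (by decide)]

end RealizabilityAlgebra

end ClassicalRealizability

theorem mainTheorem6 {M : Type*} [Membership M M] [ClassicalRealizability.ZFCModel M]
    (A : ClassicalRealizability.RealizabilityAlgebra M) (hA : A.Coherent)
    (κ : M) (hκ : ClassicalRealizability.IsCardinalOf κ A.base) :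
    -- `∀ i^{ℷ2} (i ≠ 0, i ≠ 1 → ℷκ₊ cannot be well ordered)`, where `κ₊` is the power set of `κ`
    A.Realizes (.allGimel 6 ClassicalRealizability.two (.imps
      [.ne (.var 6) (.const ClassicalRealizability.zero),
        .ne (.var 6) (.const ClassicalRealizability.one)]
      (.notWellOrderable (.const (A.gimel (ClassicalRealizability.power κ)))))) ∧
    -- `∃ i^{ℷ2} {i ≠ 0, i ≠ 1} → ∃ E {E cannot be well ordered}`
    A.Realizes (.imp
      (.exGimel 6 ClassicalRealizability.two
        [.ne (.var 6) (.const ClassicalRealizability.zero),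
          .ne (.var 6) (.const ClassicalRealizability.one)])
      (.ex 7 [.notWellOrderable (.var 7)])) := by
  constructor
  · by_contra h
    obtain ⟨S, hS, hF⟩ := ClassicalRealizability.RealizabilityAlgebra.exists_isHenkin h
    refine hF (hS.sat_allGimel.2 fun i hi => hS.sat_imp.2 fun h₀ => hS.sat_imp.2 fun h₁ => ?_)
    exact hS.sat_notWellOrderable hκ.2.1 hi (hS.sat_ne.1 h₀) (hS.sat_ne.1 h₁)
      fun _ _ _ => hS.sat_eps_gimel
  · by_contra h
    obtain ⟨S, hS, hF⟩ := ClassicalRealizability.RealizabilityAlgebra.exists_isHenkin h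
    refine hF (hS.sat_imp.2 fun hex => hS.sat_imp.2 fun hall => (hS.sat_bot
      (hS.sat_imp.1 hex (hS.sat_allGimel.2 fun i hi => hS.sat_imp.2 fun h₀ =>
        hS.sat_imp.2 fun h₁ => ?_))).elim)
    -- The individual witnessing the second formula is a name for the constant `ℷκ₊`.
    obtain ⟨E, hE⟩ := hS.exists_name (fun _ => A.gimel (ClassicalRealizability.power κ)) .base
    refine (hS.sat_bot (hS.sat_imp.1 (hS.sat_all.1 hall E) (hS.sat_notWellOrderable hκ.2.1 hi
      (hS.sat_ne.1 h₀) (hS.sat_ne.1 h₁) fun v hv i => ?_))).elim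
    rw [hS.sat_eps_var, hv, Function.update_self, hS.eps_gimel hE]
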